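/- Let $\Omega\subset\mathbb R^2$ be a domain (non-empty, open and connected), and let $(\mathcal F_1,\mathcal F_2)$ be a Liouville net in $\Omega$, i.e. a pair of orthogonal smooth ($C^\infty$) one-dimensional foliations of $\Omega$ such that near every point the coordinates $(u,v)$ obtained by smoothly parametrizing the leaves of $\mathcal F_1$ by $u$ and the leaves of $\mathcal F_2$ by $v$ bring the Euclidean metric into the form $$dx^2+dy^2=(U_1(u)-V_1(v))\,(U_2(u)\,du^2+V_2(v)\,dv^2)$$ with smooth functions $U_1,U_2,V_1,V_2$ of one variable (this condition does not depend on the choice of the parametrizations). Then, up to interchanging $\mathcal F_1$ and $\mathcal F_2$, the net is of one of the following types, where a foliation of $\Omega$ is said to be formed by a family of curves if its leaves are exactly the connected components of the intersections of these curves with $\Omega$: 1. (confocal ellipses and hyperbolas) there are two distinct points $A,B$ such that $\mathcal F_1$ is formed by the ellipses and $\mathcal F_2$ by the hyperbolas with foci $A,B$; 2. (confocal coaxial parabolas) there are a point $A$ and a line through $A$ such that $\mathcal F_1$ and $\mathcal F_2$ are formed by the parabolas with focus $A$ and that line as axis, those of $\mathcal F_1$ opening in one direction of the axis and those of $\mathcal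 F_2$ in the opposite direction; 3. (concentric circles and radial lines) there is a point $O$ such that $\mathcal F_1$ is formed by the circles centered at $O$ and $\mathcal F_2$ by the lines through $O$; 4. (orthogonal grid of lines) $\mathcal F_1$ and $\mathcal F_2$ are formed by the parallel lines in two orthogonal directions. In 1 and 2 the degenerate members of the confocal families are included: the segment $AB$ among the ellipses; the perpendicular bisector of $AB$ and the two rays of the line $AB$ starting at the foci and avoiding the open segment $AB$ among the hyperbolas; and, among the parabolas opening in a given direction of the axis, the ray of the axis starting at $A$ in that direction. -/

import Mathlib

open Set
open scoped ContDiff RealInnerProductSpace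

/-- The Euclidean plane. -/
abbrev Plane : Type := EuclideanSpace ℝ (Fin 2)

/-- `φ` is a system of smooth coordinates `(u, v)` on the open set `φ.source`, taking values in an
open coordinate rectangle. -/
def IsRectChart (φ : OpenPartialHomeomorph Plane (ℝ × ℝ)) : Prop :=
  (∃ a b c d : ℝ, φ.target = Ioo a b ×ˢ Ioo c d) ∧
    ContDiffOn ℝ ∞ φ φ.source ∧ ContDiffOn ℝ ∞ φ.symm φ.target

/-- The connected components of the intersections of the members of `leaves` with the coordinate
domain are the coordinate lines `{t = const}`, where `t` is one of the two coordinates. -/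
def Straightens (φ : OpenPartialHomeomorph Plane (ℝ × ℝ)) (t : ℝ × ℝ → ℝ)
    (leaves : Set (Set Plane)) : Prop :=
  ∀ L ∈ leaves, ∀ q ∈ L ∩ φ.source,
    connectedComponentIn (L ∩ φ.source) q = {x ∈ φ.source | t (φ x) = t (φ q)}

/-- A smooth one-dimensional foliation of `Ω`: a partition of `Ω` into path connected
leaves which near every point of `Ω` looks like the family of lines `{u = const}` in suitable
smooth coordinates `(u, v)`. -/
structure PlaneFoliation (Ω : Set Plane) where
  leaves : Set (Set Plane)
  sUnion_leaves : ⋃₀ leaves = Ω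
  disjoint_leaves : leaves.PairwiseDisjoint id
  isPathConnected_leaf : ∀ L ∈ leaves, IsPathConnected L
  exists_chart : ∀ p ∈ Ω, ∃ φ : OpenPartialHomeomorph Plane (ℝ × ℝ),
    p ∈ φ.source ∧ φ.source ⊆ Ω ∧ IsRectChart φ ∧ Straightens φ Prod.fst leaves

/-- In the coordinates `(u, v)` given by `φ`, the Euclidean metric is
`(U₁(u) - V₁(v)) (U₂(u) du² + V₂(v) dv²)` with smooth `U₁, U₂, V₁, V₂`. -/
def HasLiouvilleForm (φ : OpenPartialHomeomorph Plane (ℝ × ℝ)) : Prop :=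
  ∃ U₁ U₂ V₁ V₂ : ℝ → ℝ,
    ContDiffOn ℝ ∞ U₁ (Prod.fst '' φ.target) ∧ ContDiffOn ℝ ∞ U₂ (Prod.fst '' φ.target) ∧
    ContDiffOn ℝ ∞ V₁ (Prod.snd '' φ.target) ∧ ContDiffOn ℝ ∞ V₂ (Prod.snd '' φ.target) ∧
    ∀ w ∈ φ.target, ∀ h : ℝ × ℝ,
      ‖fderiv ℝ φ.symm w h‖ ^ 2 =
        (U₁ w.1 - V₁ w.2) * (U₂ w.1 * h.1 ^ 2 + V₂ w.2 * h.2 ^ 2)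

/-- The foliations `F₁`, `F₂` form a Liouville net: near every point, coordinates `(u, v)`, where `u`
parametrizes the leaves of `F₁` and `v` those of `F₂`, bring the metric into Liouville form.
As the form is preserved by independent changes `u ↦ ū(u)`, `v ↦ v̄(v)`, it does not matter which
parametrization of the leaves is chosen. Orthogonality of the foliations is contained in
the absence of a `du dv` term. -/
def IsLiouvilleNet {Ω : Set Plane} (F₁ F₂ : PlaneFoliation Ω) : Prop :=
  ∀ p ∈ Ω, ∃ φ : OpenPartialHomeomorph Plane (ℝ × ℝ),
    p ∈ φ.source ∧ φ.source ⊆ Ω ∧ IsRectChart φ ∧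
    Straightens φ Prod.fst F₁.leaves ∧ Straightens φ Prod.snd F₂.leaves ∧
    HasLiouvilleForm φ

/-- The leaves of `F` are the connected components of the sets `C ∩ Ω`, for `C` in the
family of curves `𝒞`. -/
def PlaneFoliation.IsFormedBy {Ω : Set Plane} (F : PlaneFoliation Ω) (𝒞 : Set (Set Plane)) : Prop :=
  F.leaves = {L | ∃ C ∈ 𝒞, ∃ p ∈ C ∩ Ω, L = connectedComponentIn (C ∩ Ω) p}

/-- The ellipses with foci `A`, `B`. The degenerate member `s = dist A B` is the segment `AB`. -/
def confocalEllipses (A B : Plane) : Set (Set Plane) :=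
  {C | ∃ s : ℝ, dist A B ≤ s ∧ C = {P | dist P A + dist P B = s}}

/-- The hyperbolas with foci `A`, `B`. The degenerate members are the perpendicular bisector of
`AB` (`s = 0`) and the two rays of the line `AB` that start at the foci and avoid the open
segment (`s = dist A B`). -/
def confocalHyperbolas (A B : Plane) : Set (Set Plane) :=
  {C | ∃ s : ℝ, 0 ≤ s ∧ s ≤ dist A B ∧ C = {P | |dist P A - dist P B| = s}}

/-- The parabolas with focus `A` whose axis points in the direction of the unit vector `e`; the
directrix is the line `⟪X - A, e⟫ = -s`. The degenerate member `s = 0` is the ray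
from `A` in the direction `e`. -/
def confocalParabolas (A e : Plane) : Set (Set Plane) :=
  {C | ∃ s : ℝ, 0 ≤ s ∧ C = {P | dist P A = ⟪P - A, e⟫ + s}}

/-- The circles with center `O`. -/
def concentricCircles (O : Plane) : Set (Set Plane) :=
  {C | ∃ r : ℝ, 0 < r ∧ C = Metric.sphere O r}

/-- The lines through `O`. -/
def radialLines (O : Plane) : Set (Set Plane) :=
  {C | ∃ e : Plane, ‖e‖ = 1 ∧ C = {P | ∃ t : ℝ, P = O + t • e}}

/-- The parallel lines with direction `e`. -/
def parallelLines (e : Plane) : Set (Set Plane) :=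
  {C | ∃ Q : Plane, C = {P | ∃ t : ℝ, P = Q + t • e}}

/-- One family consists of ellipses and the other one of hyperbolas with the same two foci. -/
def IsConfocalEllipticNet {Ω : Set Plane} (F₁ F₂ : PlaneFoliation Ω) : Prop :=
  ∃ A B : Plane, A ≠ B ∧
    ((F₁.IsFormedBy (confocalEllipses A B) ∧ F₂.IsFormedBy (confocalHyperbolas A B)) ∨
      (F₁.IsFormedBy (confocalHyperbolas A B) ∧ F₂.IsFormedBy (confocalEllipses A B)))

/-- Both families consist of parabolas with a common focus and a common axis, the two families
opening in opposite directions. -/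
def IsConfocalParabolicNet {Ω : Set Plane} (F₁ F₂ : PlaneFoliation Ω) : Prop :=
  ∃ A e : Plane, ‖e‖ = 1 ∧
    F₁.IsFormedBy (confocalParabolas A e) ∧ F₂.IsFormedBy (confocalParabolas A (-e))

/-- One family consists of circles with a common center and the other one of the lines through
that center. -/
def IsCircleRadialNet {Ω : Set Plane} (F₁ F₂ : PlaneFoliation Ω) : Prop :=
  ∃ O : Plane,
    (F₁.IsFormedBy (concentricCircles O) ∧ F₂.IsFormedBy (radialLines O)) ∨
      (F₁.IsFormedBy (radialLines O) ∧ F₂.IsFormedBy (concentricCircles O))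

/-- Each family consists of parallel lines, in two orthogonal directions. -/
def IsOrthogonalLineNet {Ω : Set Plane} (F₁ F₂ : PlaneFoliation Ω) : Prop :=
  ∃ e e' : Plane, ‖e‖ = 1 ∧ ‖e'‖ = 1 ∧ ⟪e, e'⟫ = 0 ∧
    F₁.IsFormedBy (parallelLines e) ∧ F₂.IsFormedBy (parallelLines e')

/-! Identify the plane with ℂ. Rescaling the coordinate fields of a Liouville chart by the inverse
square roots of `U₂` and `V₂` gives commuting fields X, Y for which the position ψ satisfies Yψ = ±i
Xψ, so ψ is a conformal parametrization. With g = Xψ the Liouville form says |g|² = U₁ − V₁, hence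
XY|g|² = 0, and this amounts to (X²g)/g being real. The quotient also satisfies the Cauchy–Riemann
equation, so it is a real constant c. Two integrations give g² = cψ² + 2βψ + γ. Thus the tangent
vectors of one foliation have squares that are positive multiples of a quadratic Q(z), those of the
other of −Q(z) (`HasLiouvilleForm.exists_quadratic`).

Where two charts overlap, their polynomials Q have a positive holomorphic ratio, which must be
constant. Since Ω is connected, a single Q serves everywhere (`IsLiouvilleNet.exists_quadratic`).

It remains to integrate the line field h² ∈ ℝ₊Q. If Q has two roots A, B, the tangents bisect the
angles between the focal rays, and by the reflection property of conics |z − A| − |z − B| or |z − A|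
+ |z − B| is constant on leaves. A double root gives circles and radial lines, a linear Q parabolas,
a constant Q parallel lines. `PlaneFoliation.IsDirectedBy.isFormedBy` upgrades a first integral to
the exact description of the leaves: a leaf lies in a curve of the family, and as the curve is
regular at the points of Ω, the leaf is open in it. Where the gradient of the first integral
vanishes (the segment AB and the degenerate rays), the equation of the supporting line gives the
regularity. -/

/-- The derivative of `f` along the vector field `ξ`. -/
noncomputable def derivAlong {E : Type*} [NormedAddCommGroup E] [NormedSpace ℝ E] (ξ : ℝ × ℝ → ℝ × ℝ)
    (f : ℝ × ℝ → E) (w : ℝ × ℝ) : E :=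
  fderiv ℝ f w (ξ w)

/-! ### Calculus along vector fields and the quadratic equation for the conformal derivative -/

section derivAlong

variable {R : Set (ℝ × ℝ)} {ξ η : ℝ × ℝ → ℝ × ℝ} {f g : ℝ × ℝ → ℂ}

theorem ContDiffOn.differentiableAt_of_isOpen {E F : Type*} [NormedAddCommGroup E]
    [NormedSpace ℝ E] [NormedAddCommGroup F] [NormedSpace ℝ F] {f : E → F} {R : Set E}
    (hf : ContDiffOn ℝ ∞ f R) (hR : IsOpen R) {w : E} (hw : w ∈ R) : DifferentiableAt ℝ f w :=
  (hf.contDiffAt (hR.mem_nhds hw)).differentiableAt (by simp)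

theorem ContDiffOn.derivAlong (hf : ContDiffOn ℝ ∞ f R) (hR : IsOpen R)
    (hξ : ContDiffOn ℝ ∞ ξ R) : ContDiffOn ℝ ∞ (derivAlong ξ f) R :=
  (hf.fderiv_of_isOpen hR (by simp)).clm_apply hξ

theorem derivAlong_congr (hR : IsOpen R) (h : EqOn f g R) :
    EqOn (derivAlong ξ f) (derivAlong ξ g) R := fun w hw => by
  have : f =ᶠ[nhds w] g := Filter.eventuallyEq_of_mem (hR.mem_nhds hw) h
  simp only [derivAlong, this.fderiv_eq]

theorem derivAlong_mul (hR : IsOpen R) (hf : ContDiffOn ℝ ∞ f R) (hg : ContDiffOn ℝ ∞ g R)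
    {w : ℝ × ℝ} (hw : w ∈ R) :
    derivAlong ξ (fun w => f w * g w) w = derivAlong ξ f w * g w + f w * derivAlong ξ g w := by
  simp only [derivAlong]
  rw [fderiv_fun_mul (hf.differentiableAt_of_isOpen hR hw) (hg.differentiableAt_of_isOpen hR hw)]
  simp only [add_apply, smul_apply, smul_eq_mul]
  ring

theorem derivAlong_sub (hR : IsOpen R) (hf : ContDiffOn ℝ ∞ f R) (hg : ContDiffOn ℝ ∞ g R)
    {w : ℝ × ℝ} (hw : w ∈ R) :
    derivAlong ξ (fun w => f w - g w) w = derivAlong ξ f w - derivAlong ξ g w := by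
  simp only [derivAlong]
  rw [fderiv_fun_sub (hf.differentiableAt_of_isOpen hR hw) (hg.differentiableAt_of_isOpen hR hw)]
  simp

theorem derivAlong_const_mul (hR : IsOpen R) (c : ℂ) (hf : ContDiffOn ℝ ∞ f R)
    {w : ℝ × ℝ} (hw : w ∈ R) :
    derivAlong ξ (fun w => c * f w) w = c * derivAlong ξ f w := by
  simp only [derivAlong]
  rw [fderiv_const_mul (hf.differentiableAt_of_isOpen hR hw)]
  simp

theorem ContDiffOn.conj (hf : ContDiffOn ℝ ∞ f R) :
    ContDiffOn ℝ ∞ (fun w => (starRingEnd ℂ) (f w)) R :=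
  Complex.conjCLE.contDiff.comp_contDiffOn hf

theorem derivAlong_conj (hR : IsOpen R) (hf : ContDiffOn ℝ ∞ f R) {w : ℝ × ℝ} (hw : w ∈ R) :
    derivAlong ξ (fun w => (starRingEnd ℂ) (f w)) w = (starRingEnd ℂ) (derivAlong ξ f w) := by
  have h := (Complex.conjCLE.toContinuousLinearMap.hasFDerivAt.comp w
    (hf.differentiableAt_of_isOpen hR hw).hasFDerivAt).fderiv
  have e : (fun w => (starRingEnd ℂ) (f w)) = (Complex.conjCLE.toContinuousLinearMap ∘ f) := by
    ext; simp
  rw [derivAlong, e, h]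
  simp [derivAlong]

/-- Vector fields `a(u) ∂/∂u` and `b(v) ∂/∂v` commute. -/
theorem derivAlong_comm (hR : IsOpen R) {a b : ℝ → ℝ}
    (ha' : ∀ w ∈ R, DifferentiableAt ℝ a w.1) (hb' : ∀ w ∈ R, DifferentiableAt ℝ b w.2)
    (hf : ContDiffOn ℝ ∞ f R) {w : ℝ × ℝ} (hw : w ∈ R) :
    derivAlong (fun w => (a w.1, 0)) (derivAlong (fun w => (0, b w.2)) f) w =
      derivAlong (fun w => (0, b w.2)) (derivAlong (fun w => (a w.1, 0)) f) w := by
  have h2 : DifferentiableAt ℝ (fderiv ℝ f) w :=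
    (hf.fderiv_of_isOpen (m := ∞) hR (by simp)).differentiableAt_of_isOpen hR hw
  have hsymm : IsSymmSndFDerivAt ℝ f w :=
    (hf.contDiffAt (hR.mem_nhds hw)).isSymmSndFDerivAt (by simp; exact WithTop.coe_le_coe.2 (le_top (a := (2 : ℕ∞))))
  have hA : HasFDerivAt (fun w : ℝ × ℝ => ((a w.1, 0) : ℝ × ℝ))
      (((fderiv ℝ a w.1).comp (ContinuousLinearMap.fst ℝ ℝ ℝ)).prod 0) w :=
    HasFDerivAt.prodMk ((ha' w hw).hasFDerivAt.comp w hasFDerivAt_fst) (hasFDerivAt_const _ _)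
  have hB : HasFDerivAt (fun w : ℝ × ℝ => ((0, b w.2) : ℝ × ℝ))
      (ContinuousLinearMap.prod 0 ((fderiv ℝ b w.2).comp (ContinuousLinearMap.snd ℝ ℝ ℝ))) w :=
    HasFDerivAt.prodMk (hasFDerivAt_const _ _) ((hb' w hw).hasFDerivAt.comp w hasFDerivAt_snd)
  have eA := (h2.hasFDerivAt.clm_apply hA).fderiv
  have eB := (h2.hasFDerivAt.clm_apply hB).fderiv
  have key : ∀ x y, fderiv ℝ (fderiv ℝ f) w x y = fderiv ℝ (fderiv ℝ f) w y x := hsymm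
  unfold derivAlong
  rw [eA, eB]
  simp [key (a w.1, 0) (0, b w.2)]

theorem exists_const_of_derivAlong_eq_zero (hR : IsOpen R) (hc : IsPreconnected R)
    (hne : R.Nonempty) {a b : ℝ → ℝ} (ha : ∀ w ∈ R, a w.1 ≠ 0) (hb : ∀ w ∈ R, b w.2 ≠ 0)
    (hf : ContDiffOn ℝ ∞ f R)
    (h1 : ∀ w ∈ R, derivAlong (fun w => (a w.1, 0)) f w = 0)
    (h2 : ∀ w ∈ R, derivAlong (fun w => (0, b w.2)) f w = 0) :
    ∃ c, ∀ w ∈ R, f w = c := by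
  obtain ⟨w₀, hw₀⟩ := hne
  refine ⟨f w₀, fun w hw => ?_⟩
  refine hR.is_const_of_fderiv_eq_zero hc
    (fun w hw => (hf.differentiableAt_of_isOpen hR hw).differentiableWithinAt) ?_ hw hw₀
  intro w hw
  ext
  · have := h1 w hw
    have e : ((a w.1, 0) : ℝ × ℝ) = a w.1 • ((1, 0) : ℝ × ℝ) := by simp
    simp only [derivAlong, e, map_smul, smul_eq_zero, ha w hw, false_or] at this
    simpa using this
  · have := h2 w hw
    have e : ((0, b w.2) : ℝ × ℝ) = b w.2 • ((0, 1) : ℝ × ℝ) := by simp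
    simp only [derivAlong, e, map_smul, smul_eq_zero, hb w hw, false_or] at this
    simpa using this

end derivAlong

/-- A conformal parametrization `ψ` (with respect to the commuting vector fields `a(u) ∂/∂u` and
`b(v) ∂/∂v`) whose conformal factor is the sum of a function of `u` and a function of `v`: the
square of its complex derivative is a quadratic polynomial in `ψ` with real leading coefficient. -/
theorem exists_quadratic_of_conformal {R : Set (ℝ × ℝ)} (hR : IsOpen R) (hc : IsPreconnected R)
    (hne : R.Nonempty) {a b : ℝ → ℝ}
    (ha : ContDiffOn ℝ ∞ (fun w : ℝ × ℝ => a w.1) R)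
    (hb : ContDiffOn ℝ ∞ (fun w : ℝ × ℝ => b w.2) R)
    (ha' : ∀ w ∈ R, DifferentiableAt ℝ a w.1) (hb' : ∀ w ∈ R, DifferentiableAt ℝ b w.2)
    (ha0 : ∀ w ∈ R, a w.1 ≠ 0) (hb0 : ∀ w ∈ R, b w.2 ≠ 0)
    {ψ : ℝ × ℝ → ℂ} (hψ : ContDiffOn ℝ ∞ ψ R) {s : ℝ} (hs : s ≠ 0)
    (hY : ∀ w ∈ R, derivAlong (fun w => (0, b w.2)) ψ w =
      s * Complex.I * derivAlong (fun w => (a w.1, 0)) ψ w)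
    (hX0 : ∀ w ∈ R, derivAlong (fun w => (a w.1, 0)) ψ w ≠ 0)
    {A B : ℝ × ℝ → ℂ} (hA : ContDiffOn ℝ ∞ A R) (hB : ContDiffOn ℝ ∞ B R)
    (hYA : ∀ w ∈ R, derivAlong (fun w => (0, b w.2)) A w = 0)
    (hXB : ∀ w ∈ R, derivAlong (fun w => (a w.1, 0)) B w = 0)
    (hW : ∀ w ∈ R, derivAlong (fun w => (a w.1, 0)) ψ w *
      (starRingEnd ℂ) (derivAlong (fun w => (a w.1, 0)) ψ w) = A w - B w) :
    ∃ (c : ℝ) (β γ : ℂ), ∀ w ∈ R, derivAlong (fun w => (a w.1, 0)) ψ w ^ 2 =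
      c * ψ w ^ 2 + 2 * β * ψ w + γ := by
  set ξ : ℝ × ℝ → ℝ × ℝ := fun w => (a w.1, 0) with hξd
  set η : ℝ × ℝ → ℝ × ℝ := fun w => (0, b w.2) with hηd
  have hξ : ContDiffOn ℝ ∞ ξ R := ha.prodMk contDiffOn_const
  have hη : ContDiffOn ℝ ∞ η R := contDiffOn_const.prodMk hb
  have comm : ∀ {f : ℝ × ℝ → ℂ}, ContDiffOn ℝ ∞ f R → ∀ w ∈ R,
      derivAlong ξ (derivAlong η f) w = derivAlong η (derivAlong ξ f) w :=
    fun hf w hw => derivAlong_comm hR ha' hb' hf hw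
  -- The Cauchy–Riemann equation is inherited by the derivative along ξ, because ξ and η commute.
  have step : ∀ {f : ℝ × ℝ → ℂ}, ContDiffOn ℝ ∞ f R →
      (∀ w ∈ R, derivAlong η f w = s * Complex.I * derivAlong ξ f w) →
      ∀ w ∈ R, derivAlong η (derivAlong ξ f) w = s * Complex.I * derivAlong ξ (derivAlong ξ f) w := by
    intro f hf h w hw
    rw [← comm hf w hw, derivAlong_congr hR h hw, derivAlong_const_mul hR _ (hf.derivAlong hR hξ) hw]
  have const := fun {f : ℝ × ℝ → ℂ} =>
    exists_const_of_derivAlong_eq_zero (f := f) hR hc hne ha0 hb0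
  set g := derivAlong ξ ψ with hg
  set g₁ := derivAlong ξ g with hg₁
  set g₂ := derivAlong ξ g₁ with hg₂
  have sg : ContDiffOn ℝ ∞ g R := hψ.derivAlong hR hξ
  have sg₁ : ContDiffOn ℝ ∞ g₁ R := sg.derivAlong hR hξ
  have sg₂ : ContDiffOn ℝ ∞ g₂ R := sg₁.derivAlong hR hξ
  have Yg := step hψ hY
  have Yg₁ := step sg Yg
  have Yg₂ := step sg₁ Yg₁
  have hsI : (s : ℂ) * Complex.I ≠ 0 := by simp [hs]
  -- Apply ξη to |g|² = A − B. The right side vanishes since η kills A and ξ kills B; the left side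
  -- is s·i·(g₂ ḡ − g ḡ₂), the terms g₁ ḡ₁ cancelling.
  have real : ∀ w ∈ R, g₂ w * (starRingEnd ℂ) (g w) = g w * (starRingEnd ℂ) (g₂ w) := by
    intro w hw
    have e1 : EqOn (derivAlong η (fun w => g w * (starRingEnd ℂ) (g w)))
        (fun w => s * Complex.I * (g₁ w * (starRingEnd ℂ) (g w) - g w * (starRingEnd ℂ) (g₁ w)))
        R := by
      intro w hw
      rw [derivAlong_mul hR sg sg.conj hw, derivAlong_conj hR sg hw, Yg w hw]
      simp only [map_mul, Complex.conj_ofReal, Complex.conj_I]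
      ring
    have e2 : derivAlong ξ (derivAlong η (fun w => g w * (starRingEnd ℂ) (g w))) w = 0 := by
      have : EqOn (derivAlong η (fun w => g w * (starRingEnd ℂ) (g w)))
          (fun w => derivAlong η A w - derivAlong η B w) R := fun w hw => by
        rw [derivAlong_congr hR (f := fun w => g w * (starRingEnd ℂ) (g w))
          (g := fun w => A w - B w) hW hw, derivAlong_sub hR hA hB hw]
      have z : ∀ ζ : ℝ × ℝ → ℝ × ℝ, derivAlong ζ (fun _ => (0 : ℂ)) w = 0 := by
        intro ζ; simp [derivAlong]
      rw [derivAlong_congr hR this hw,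
        derivAlong_sub hR (hA.derivAlong hR hη) (hB.derivAlong hR hη) hw, comm hB w hw,
        derivAlong_congr hR (g := fun _ => (0 : ℂ)) hYA hw,
        derivAlong_congr hR (g := fun _ => (0 : ℂ)) hXB hw, z, z, sub_zero]
    rw [derivAlong_congr hR e1 hw, derivAlong_const_mul hR _
      ((sg₁.mul sg.conj).sub (sg.mul sg₁.conj)) hw,
      derivAlong_sub hR (sg₁.mul sg.conj) (sg.mul sg₁.conj) hw, derivAlong_mul hR sg₁ sg.conj hw,
      derivAlong_mul hR sg sg₁.conj hw, derivAlong_conj hR sg hw, derivAlong_conj hR sg₁ hw] at e2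
    have := (mul_eq_zero.1 e2).resolve_left hsI
    linear_combination this
  obtain ⟨c, hcg⟩ : ∃ c : ℝ, ∀ w ∈ R, g₂ w = c * g w := by
    set h : ℝ × ℝ → ℂ := fun w => g₂ w / g w with hh
    have sh : ContDiffOn ℝ ∞ h R := by
      simp only [hh, div_eq_mul_inv]
      exact sg₂.mul (sg.inv hX0)
    have hmul : EqOn g₂ (fun w => h w * g w) R := fun w hw => by simp [hh, hX0 w hw]
    have hconj : EqOn (fun w => (starRingEnd ℂ) (h w)) h R := by
      intro w hw
      have h0 : (starRingEnd ℂ) (g w) ≠ 0 := by simpa using hX0 w hw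
      simp only [hh, map_div₀]
      rw [div_eq_div_iff h0 (hX0 w hw)]
      linear_combination -(real w hw)
    have hYh : ∀ w ∈ R, derivAlong η h w = s * Complex.I * derivAlong ξ h w := by
      intro w hw
      have e := Yg₂ w hw
      rw [derivAlong_congr hR hmul hw, derivAlong_congr (ξ := ξ) hR hmul hw,
        derivAlong_mul hR sh sg hw, derivAlong_mul hR sh sg hw, Yg w hw] at e
      apply mul_right_cancel₀ (hX0 w hw)
      linear_combination e
    -- As h is real, its derivatives along ξ and η are both real, while the Cauchy–Riemann equation
    -- makes one an imaginary multiple of the other; so both vanish.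
    have hXh : ∀ w ∈ R, derivAlong ξ h w = 0 := by
      intro w hw
      have e1 := derivAlong_conj (ξ := ξ) hR sh hw
      have e2 := derivAlong_conj (ξ := η) hR sh hw
      rw [derivAlong_congr hR hconj hw] at e1 e2
      rw [hYh w hw, map_mul, ← e1] at e2
      simp only [map_mul, Complex.conj_ofReal, Complex.conj_I] at e2
      have : (2 * (s * Complex.I)) * derivAlong ξ h w = 0 := by linear_combination e2
      exact (mul_eq_zero.1 this).resolve_left (mul_ne_zero two_ne_zero hsI)
    obtain ⟨c, hc'⟩ := const sh hXh fun w hw => by rw [hYh w hw, hXh w hw, mul_zero]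
    obtain ⟨w₀, hw₀⟩ := hne
    have hcr : (starRingEnd ℂ) c = c := by
      rw [← hc' w₀ hw₀]; exact hconj hw₀
    obtain ⟨r, rfl⟩ := Complex.conj_eq_iff_real.1 hcr
    exact ⟨r, fun w hw => by rw [hmul hw]; simp only [hc' w hw]⟩
  have sc := fun (k : ℂ) {f : ℝ × ℝ → ℂ} (hf : ContDiffOn ℝ ∞ f R) =>
    (contDiffOn_const (c := k)).mul hf
  obtain ⟨β, hβ⟩ : ∃ β, ∀ w ∈ R, g₁ w - c * ψ w = β := by
    refine const (sg₁.sub (sc _ hψ)) (fun w hw => ?_) fun w hw => ?_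
    · rw [derivAlong_sub hR sg₁ (sc _ hψ) hw, derivAlong_const_mul hR _ hψ hw]
      exact sub_eq_zero.2 (hcg w hw)
    · rw [derivAlong_sub hR sg₁ (sc _ hψ) hw, derivAlong_const_mul hR _ hψ hw, Yg₁ w hw, hY w hw]
      have := hcg w hw
      simp only [hg₂] at this
      rw [this]; ring
  -- The energy integral of g₁ = cψ + β: multiplied by 2g, the equation is an exact derivative.
  obtain ⟨γ, hγ⟩ : ∃ γ, ∀ w ∈ R, g w * g w - (c * (ψ w * ψ w)) - 2 * β * ψ w = γ := by
    have s1 := sg.mul sg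
    have s2 := sc c (hψ.mul hψ)
    have s3 := sc (2 * β) hψ
    have D : ∀ ζ : ℝ × ℝ → ℝ × ℝ, ∀ w ∈ R,
        derivAlong ζ (fun w => g w * g w - (c * (ψ w * ψ w)) - 2 * β * ψ w) w =
          2 * (g w * derivAlong ζ g w - (c * ψ w + β) * derivAlong ζ ψ w) := by
      intro ζ w hw
      rw [derivAlong_sub hR (s1.sub s2) s3 hw, derivAlong_sub hR s1 s2 hw,
        derivAlong_mul hR sg sg hw, derivAlong_const_mul hR _ (hψ.mul hψ) hw,
        derivAlong_mul hR hψ hψ hw, derivAlong_const_mul hR _ hψ hw]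
      ring
    refine const ((s1.sub s2).sub s3) (fun w hw => ?_) fun w hw => ?_
    · rw [D ξ w hw]
      linear_combination 2 * g w * hβ w hw
    · rw [D η w hw, Yg w hw, hY w hw]
      linear_combination 2 * (s * Complex.I) * g w * hβ w hw
  exact ⟨c, β, γ, fun w hw => by linear_combination hγ w hw⟩

/-- The identification of the Euclidean plane with the complex plane. -/
noncomputable def planeToComplex : Plane ≃ₗᵢ[ℝ] ℂ := Complex.orthonormalBasisOneI.repr.symm

/-! ### Liouville charts -/

section chart

variable {φ : OpenPartialHomeomorph Plane (ℝ × ℝ)}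

theorem IsRectChart.differentiableAt_symm (h : IsRectChart φ) {w : ℝ × ℝ} (hw : w ∈ φ.target) :
    DifferentiableAt ℝ φ.symm w :=
  h.2.2.differentiableAt_of_isOpen φ.open_target hw

theorem IsRectChart.differentiableAt (h : IsRectChart φ) {x : Plane} (hx : x ∈ φ.source) :
    DifferentiableAt ℝ φ x :=
  h.2.1.differentiableAt_of_isOpen φ.open_source hx

theorem IsRectChart.fderiv_fderiv_symm (h : IsRectChart φ) {w : ℝ × ℝ} (hw : w ∈ φ.target)
    (k : ℝ × ℝ) : fderiv ℝ φ (φ.symm w) (fderiv ℝ φ.symm w k) = k := by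
  have h1 := (h.differentiableAt (φ.map_target hw)).hasFDerivAt.comp w
    (h.differentiableAt_symm hw).hasFDerivAt
  have e : (φ ∘ φ.symm) =ᶠ[nhds w] id :=
    Filter.eventuallyEq_of_mem (φ.open_target.mem_nhds hw) fun y hy => φ.right_inv hy
  have := (h1.congr_of_eventuallyEq e.symm).unique (hasFDerivAt_id w)
  exact DFunLike.congr_fun this k

theorem IsRectChart.fderiv_symm_ne_zero (h : IsRectChart φ) {w : ℝ × ℝ} (hw : w ∈ φ.target)
    {k : ℝ × ℝ} (hk : k ≠ 0) : fderiv ℝ φ.symm w k ≠ 0 := fun h0 => hk <| by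
  rw [← h.fderiv_fderiv_symm hw k, h0, map_zero]

theorem IsRectChart.isPreconnected_target (h : IsRectChart φ) : IsPreconnected φ.target := by
  obtain ⟨a, b, c, d, e⟩ := h.1
  rw [e]
  exact isPreconnected_Ioo.prod isPreconnected_Ioo

/-- Positivity of the metric on the coordinate vectors only fixes the signs of products. The three
factors have one common sign on the whole rectangle, and if it is negative, negating all four
functions leaves the metric unchanged. -/
theorem HasLiouvilleForm.exists_pos (hφ : IsRectChart φ) (hne : φ.target.Nonempty)
    (h : HasLiouvilleForm φ) :
    ∃ U₁ U₂ V₁ V₂ : ℝ → ℝ,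
    ContDiffOn ℝ ∞ U₁ (Prod.fst '' φ.target) ∧ ContDiffOn ℝ ∞ U₂ (Prod.fst '' φ.target) ∧
    ContDiffOn ℝ ∞ V₁ (Prod.snd '' φ.target) ∧ ContDiffOn ℝ ∞ V₂ (Prod.snd '' φ.target) ∧
    (∀ w ∈ φ.target, 0 < U₁ w.1 - V₁ w.2 ∧ 0 < U₂ w.1 ∧ 0 < V₂ w.2) ∧
    ∀ w ∈ φ.target, ∀ h : ℝ × ℝ,
      ‖fderiv ℝ φ.symm w h‖ ^ 2 =
        (U₁ w.1 - V₁ w.2) * (U₂ w.1 * h.1 ^ 2 + V₂ w.2 * h.2 ^ 2) := by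
  obtain ⟨U₁, U₂, V₁, V₂, h1, h2, h3, h4, h5⟩ := h
  have pU : ∀ w ∈ φ.target, 0 < (U₁ w.1 - V₁ w.2) * U₂ w.1 := by
    intro w hw
    have := h5 w hw (1, 0)
    have hn := hφ.fderiv_symm_ne_zero hw (k := (1, 0)) (by simp)
    have hp : 0 < ‖fderiv ℝ φ.symm w (1, 0)‖ ^ 2 := by positivity
    rw [this] at hp
    simpa using hp
  have pV : ∀ w ∈ φ.target, 0 < (U₁ w.1 - V₁ w.2) * V₂ w.2 := by
    intro w hw
    have := h5 w hw (0, 1)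
    have hn := hφ.fderiv_symm_ne_zero hw (k := (0, 1)) (by simp)
    have hp : 0 < ‖fderiv ℝ φ.symm w (0, 1)‖ ^ 2 := by positivity
    rw [this] at hp
    simpa using hp
  obtain ⟨⟨u₀, v₀⟩, hw₀⟩ := hne
  obtain ⟨a, b, c, d, e⟩ := hφ.1
  -- The rectangular shape lets signs be carried from the line u = u₀ to every point.
  have mem : ∀ w ∈ φ.target, (u₀, w.2) ∈ φ.target := by
    rw [e] at hw₀ ⊢
    exact fun w hw => ⟨hw₀.1, hw.2⟩
  rcases lt_or_ge 0 (U₂ u₀) with hp | hp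
  · refine ⟨U₁, U₂, V₁, V₂, h1, h2, h3, h4, fun w hw => ?_, h5⟩
    have a1 : 0 < U₁ u₀ - V₁ w.2 := pos_of_mul_pos_left (pU _ (mem w hw)) hp.le
    have a2 : 0 < V₂ w.2 := pos_of_mul_pos_right (pV (u₀, w.2) (mem w hw)) a1.le
    have a3 : 0 < U₁ w.1 - V₁ w.2 := pos_of_mul_pos_left (pV _ hw) a2.le
    exact ⟨a3, pos_of_mul_pos_right (pU _ hw) a3.le, a2⟩
  · refine ⟨-U₁, -U₂, -V₁, -V₂, h1.neg, h2.neg, h3.neg, h4.neg, fun w hw => ?_, fun w hw k => ?_⟩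
    · have a1 : U₁ u₀ - V₁ w.2 < 0 := neg_of_mul_pos_left (pU _ (mem w hw)) hp
      have a2 : V₂ w.2 < 0 := neg_of_mul_pos_right (pV (u₀, w.2) (mem w hw)) a1.le
      have a3 : U₁ w.1 - V₁ w.2 < 0 := neg_of_mul_pos_left (pV _ hw) a2.le
      have a4 := neg_of_mul_pos_right (pU _ hw) a3.le
      simp only [Pi.neg_apply]
      exact ⟨by linarith, by linarith, by linarith⟩
    · rw [h5 w hw k]
      simp only [Pi.neg_apply]
      ring

/-- In a Liouville chart the squares of the coordinate vectors are, up to positive and negative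
factors, the values of a quadratic polynomial with real leading coefficient. -/
theorem HasLiouvilleForm.exists_quadratic (hφ : IsRectChart φ) (hne : φ.target.Nonempty)
    (h : HasLiouvilleForm φ) :
    ∃ (c : ℝ) (β γ : ℂ), ∀ w ∈ φ.target,
      (∃ r : ℝ, 0 < r ∧ planeToComplex (fderiv ℝ φ.symm w (1, 0)) ^ 2 =
        r * (c * planeToComplex (φ.symm w) ^ 2 + 2 * β * planeToComplex (φ.symm w) + γ)) ∧
      ∃ r : ℝ, 0 < r ∧ planeToComplex (fderiv ℝ φ.symm w (0, 1)) ^ 2 =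
        r * -(c * planeToComplex (φ.symm w) ^ 2 + 2 * β * planeToComplex (φ.symm w) + γ) := by
  obtain ⟨U₁, U₂, V₁, V₂, h1, h2, h3, h4, hpos, h5⟩ := h.exists_pos hφ hne
  have hR := φ.open_target
  have hc := hφ.isPreconnected_target
  have oU : IsOpen (Prod.fst '' φ.target) := isOpenMap_fst _ hR
  have oV : IsOpen (Prod.snd '' φ.target) := isOpenMap_snd _ hR
  have mU : MapsTo Prod.fst φ.target (Prod.fst '' φ.target) := mapsTo_image _ _
  have mV : MapsTo Prod.snd φ.target (Prod.snd '' φ.target) := mapsTo_image _ _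
  set a : ℝ → ℝ := fun u => (√(U₂ u))⁻¹ with had
  set b : ℝ → ℝ := fun v => (√(V₂ v))⁻¹ with hbd
  have sa : ContDiffOn ℝ ∞ a (Prod.fst '' φ.target) := by
    refine (h2.sqrt ?_).inv ?_
    · rintro _ ⟨w, hw, rfl⟩; exact (hpos w hw).2.1.ne'
    · rintro _ ⟨w, hw, rfl⟩; exact (Real.sqrt_pos.2 (hpos w hw).2.1).ne'
  have sb : ContDiffOn ℝ ∞ b (Prod.snd '' φ.target) := by
    refine (h4.sqrt ?_).inv ?_
    · rintro _ ⟨w, hw, rfl⟩; exact (hpos w hw).2.2.ne'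
    · rintro _ ⟨w, hw, rfl⟩; exact (Real.sqrt_pos.2 (hpos w hw).2.2).ne'
  have pa : ∀ w ∈ φ.target, 0 < a w.1 ∧ a w.1 ^ 2 * U₂ w.1 = 1 := fun w hw => by
    have := (hpos w hw).2.1
    refine ⟨by positivity, ?_⟩
    simp only [had, inv_pow, Real.sq_sqrt this.le]
    exact inv_mul_cancel₀ this.ne'
  have pb : ∀ w ∈ φ.target, 0 < b w.2 ∧ b w.2 ^ 2 * V₂ w.2 = 1 := fun w hw => by
    have := (hpos w hw).2.2
    refine ⟨by positivity, ?_⟩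
    simp only [hbd, inv_pow, Real.sq_sqrt this.le]
    exact inv_mul_cancel₀ this.ne'
  set ψ : ℝ × ℝ → ℂ := fun w => planeToComplex (φ.symm w) with hψd
  have hψ : ContDiffOn ℝ ∞ ψ φ.target :=
    planeToComplex.toContinuousLinearEquiv.contDiff.comp_contDiffOn hφ.2.2
  have dψ : ∀ w ∈ φ.target, ∀ k, fderiv ℝ ψ w k = planeToComplex (fderiv ℝ φ.symm w k) := by
    intro w hw k
    have := (planeToComplex.toContinuousLinearEquiv.toContinuousLinearMap.hasFDerivAt.comp w
      (hφ.differentiableAt_symm hw).hasFDerivAt).fderiv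
    exact DFunLike.congr_fun this k
  set X := derivAlong (fun w => (a w.1, 0)) ψ with hX
  set Y := derivAlong (fun w => (0, b w.2)) ψ with hY
  have eX : ∀ w ∈ φ.target, X w = a w.1 * planeToComplex (fderiv ℝ φ.symm w (1, 0)) := by
    intro w hw
    have e : ((a w.1, 0) : ℝ × ℝ) = a w.1 • ((1, 0) : ℝ × ℝ) := by simp
    simp only [hX, derivAlong]
    rw [e, map_smul, dψ w hw, Complex.real_smul]
  have eY : ∀ w ∈ φ.target, Y w = b w.2 * planeToComplex (fderiv ℝ φ.symm w (0, 1)) := by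
    intro w hw
    have e : ((0, b w.2) : ℝ × ℝ) = b w.2 • ((0, 1) : ℝ × ℝ) := by simp
    simp only [hY, derivAlong]
    rw [e, map_smul, dψ w hw, Complex.real_smul]
  -- The rescaled fields `X`, `Y` are orthogonal and of equal length, with squared length U₁ − V₁.
  have met : ∀ w ∈ φ.target, ∀ s t : ℝ, Complex.normSq (s * X w + t * Y w) =
      (U₁ w.1 - V₁ w.2) * (s ^ 2 + t ^ 2) := by
    intro w hw s t
    have e := h5 w hw (s * a w.1, t * b w.2)
    have e2 : s * X w + t * Y w =
        planeToComplex (fderiv ℝ φ.symm w (s * a w.1, t * b w.2)) := by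
      have : ((s * a w.1, t * b w.2) : ℝ × ℝ) =
        (s * a w.1) • ((1, 0) : ℝ × ℝ) + (t * b w.2) • ((0, 1) : ℝ × ℝ) := by simp
      rw [this, map_add, map_smul, map_smul, map_add, map_smul, map_smul, eX w hw, eY w hw]
      simp only [Complex.real_smul]
      push_cast
      ring
    rw [Complex.normSq_eq_norm_sq, e2, LinearIsometryEquiv.norm_map, e]
    linear_combination (U₁ w.1 - V₁ w.2) * (s ^ 2 * (pa w hw).2 + t ^ 2 * (pb w hw).2)
  have hXX : ∀ w ∈ φ.target, X w ≠ 0 := fun w hw h0 => by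
    have := met w hw 1 0
    have h := (hpos w hw).1
    simp [h0] at this
    exact h.ne this
  have sX : ContDiffOn ℝ ∞ X φ.target :=
    hψ.derivAlong hR ((sa.comp contDiffOn_fst mU).prodMk contDiffOn_const)
  have sY : ContDiffOn ℝ ∞ Y φ.target :=
    hψ.derivAlong hR (contDiffOn_const.prodMk (sb.comp contDiffOn_snd mV))
  -- For q = Y/X the metric gives |q|² = 1 and |1 + q|² = 2, whence Re q = 0 and q = ±i.
  have quot : ∀ w ∈ φ.target, (Y w / X w).re = 0 ∧ (Y w / X w).im ^ 2 = 1 := by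
    intro w hw
    have hq : Y w = (Y w / X w) * X w := by field_simp [hXX w hw]
    have m1 := met w hw 1 0
    have m2 := met w hw 0 1
    have m3 := met w hw 1 1
    have hW := (hpos w hw).1
    generalize Y w / X w = q at hq
    simp only [Complex.ofReal_one, Complex.ofReal_zero, one_mul, zero_mul, add_zero, zero_add,
      one_pow, mul_one, ne_eq, OfNat.ofNat_ne_zero, not_false_eq_true, zero_pow] at m1 m2 m3
    have e3 : X w + Y w = (1 + q) * X w := by rw [hq]; ring
    rw [e3, map_mul, m1] at m3
    rw [hq, map_mul, m1] at m2
    have n2 : Complex.normSq q = 1 := by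
      apply mul_right_cancel₀ hW.ne'; rw [m2, one_mul]
    have n3 : Complex.normSq (1 + q) = 2 := by
      apply mul_right_cancel₀ hW.ne'; rw [m3]; ring
    simp only [Complex.normSq_apply, Complex.add_re, Complex.add_im, Complex.one_re,
      Complex.one_im] at n2 n3
    have hre : q.re = 0 := by linarith
    refine ⟨hre, ?_⟩
    rw [hre] at n2
    linarith
  -- The sign is the orientation of the chart; it is constant by continuity on the connected
  -- rectangle.
  obtain ⟨s, hs, hsq⟩ : ∃ s : ℝ, s ^ 2 = 1 ∧ ∀ w ∈ φ.target, (Y w / X w).im = s := by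
    have cont : ContinuousOn (fun w => (Y w / X w).im) φ.target :=
      Complex.continuous_im.comp_continuousOn (sY.continuousOn.div sX.continuousOn hXX)
    rcases hc.eq_one_or_eq_neg_one_of_sq_eq cont (fun w hw => by simpa using (quot w hw).2)
      with h | h
    · exact ⟨1, by norm_num, fun w hw => by simpa using h hw⟩
    · exact ⟨-1, by norm_num, fun w hw => by simpa using h hw⟩
  have hs0 : s ≠ 0 := by rintro rfl; norm_num at hs
  have hYX : ∀ w ∈ φ.target, Y w = s * Complex.I * X w := by
    intro w hw
    have : Y w / X w = s * Complex.I := by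
      apply Complex.ext
      · simp [(quot w hw).1]
      · simp [hsq w hw]
    rw [← this, div_mul_cancel₀ _ (hXX w hw)]
  have dU : ∀ w ∈ φ.target, DifferentiableAt ℝ U₁ w.1 := fun w hw =>
    h1.differentiableAt_of_isOpen oU (mU hw)
  have dV : ∀ w ∈ φ.target, DifferentiableAt ℝ V₁ w.2 := fun w hw =>
    h3.differentiableAt_of_isOpen oV (mV hw)
  obtain ⟨c, β, γ, hQ⟩ := exists_quadratic_of_conformal hR hc hne
    (sa.comp contDiffOn_fst mU) (sb.comp contDiffOn_snd mV)
    (fun w hw => sa.differentiableAt_of_isOpen oU (mU hw))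
    (fun w hw => sb.differentiableAt_of_isOpen oV (mV hw))
    (fun w hw => (pa w hw).1.ne') (fun w hw => (pb w hw).1.ne') hψ hs0 hYX hXX
    (A := fun w => (U₁ w.1 : ℂ)) (B := fun w => (V₁ w.2 : ℂ))
    (Complex.ofRealCLM.contDiff.comp_contDiffOn (h1.comp contDiffOn_fst mU))
    (Complex.ofRealCLM.contDiff.comp_contDiffOn (h3.comp contDiffOn_snd mV))
    (fun w hw => by
      have := (Complex.ofRealCLM.hasFDerivAt.comp w
        ((dU w hw).hasFDerivAt.comp w hasFDerivAt_fst)).fderiv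
      exact (DFunLike.congr_fun this _).trans (by simp))
    (fun w hw => by
      have := (Complex.ofRealCLM.hasFDerivAt.comp w
        ((dV w hw).hasFDerivAt.comp w hasFDerivAt_snd)).fderiv
      exact (DFunLike.congr_fun this _).trans (by simp))
    (fun w hw => by
      have := met w hw 1 0
      rw [Complex.mul_conj]
      simp only [Complex.ofReal_one, Complex.ofReal_zero, one_mul, zero_mul, add_zero] at this
      rw [this]
      push_cast; ring)
  refine ⟨c, β, γ, fun w hw => ?_⟩
  have hQ := hQ w hw
  have ha := (pa w hw).1
  have hb := (pb w hw).1
  have ha' : (a w.1 : ℂ) ≠ 0 := by exact_mod_cast ha.ne'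
  have hb' : (b w.2 : ℂ) ≠ 0 := by exact_mod_cast hb.ne'
  have hs' : (s : ℂ) ^ 2 = 1 := by exact_mod_cast hs
  refine ⟨⟨(a w.1 ^ 2)⁻¹, by positivity, ?_⟩, ⟨(b w.2 ^ 2)⁻¹, by positivity, ?_⟩⟩
  · rw [← hQ]
    change _ = _ * X w ^ 2
    rw [eX w hw]
    push_cast
    field_simp
  · rw [← hQ]
    change _ = _ * -X w ^ 2
    have : -X w ^ 2 = Y w ^ 2 := by
      rw [hYX w hw, mul_pow, mul_pow, hs', Complex.I_sq]; ring
    rw [this, eY w hw]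
    push_cast
    field_simp

end chart

/-! ### Directed foliations, first integrals and leaves -/

/-- The squares of the tangent vectors of the leaves are positive multiples of `Q`, in charts of
the foliation near every point. -/
def PlaneFoliation.IsDirectedBy {Ω : Set Plane} (F : PlaneFoliation Ω) (Q : ℂ → ℂ) : Prop :=
  ∀ p ∈ Ω, ∃ φ : OpenPartialHomeomorph Plane (ℝ × ℝ),
    p ∈ φ.source ∧ φ.source ⊆ Ω ∧ IsRectChart φ ∧ Straightens φ Prod.fst F.leaves ∧
    ∀ w ∈ φ.target, ∃ r : ℝ, 0 < r ∧
      planeToComplex (fderiv ℝ φ.symm w (0, 1)) ^ 2 = r * Q (planeToComplex (φ.symm w))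

/-- `f` has derivative zero in the directions `h` for which `h ^ 2` is a positive multiple
of `Q`. -/
def IsFirstIntegralAt {E : Type*} [NormedAddCommGroup E] [NormedSpace ℝ E] (Q : ℂ → ℂ)
    (f : ℂ → E) (z : ℂ) : Prop :=
  ∃ f' : ℂ →L[ℝ] E, HasFDerivAt f f' z ∧
    ∀ (h : ℂ) (r : ℝ), 0 < r → h ^ 2 = r * Q z → f' h = 0

theorem IsRectChart.hasDerivAt_snd {φ : OpenPartialHomeomorph Plane (ℝ × ℝ)} (hφ : IsRectChart φ)
    {u t : ℝ} (hw : (u, t) ∈ φ.target) :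
    HasDerivAt (fun t => planeToComplex (φ.symm (u, t)))
      (planeToComplex (fderiv ℝ φ.symm (u, t) (0, 1))) t := by
  have h1 : HasDerivAt (fun t : ℝ => ((u, t) : ℝ × ℝ)) (0, 1) t :=
    (hasDerivAt_const t u).prodMk (hasDerivAt_id t)
  exact planeToComplex.toContinuousLinearEquiv.toContinuousLinearMap.hasFDerivAt.comp_hasDerivAt t
    ((hφ.differentiableAt_symm hw).hasFDerivAt.comp_hasDerivAt t h1)

section leaves

variable {Ω : Set Plane} {F : PlaneFoliation Ω} {Q : ℂ → ℂ}

theorem PlaneFoliation.IsDirectedBy.ne_zero (hF : F.IsDirectedBy Q) {p : Plane} (hp : p ∈ Ω) :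
    Q (planeToComplex p) ≠ 0 := by
  obtain ⟨φ, hpφ, -, hφ, -, h⟩ := hF p hp
  obtain ⟨r, -, e⟩ := h (φ p) (φ.map_source hpφ)
  rw [φ.left_inv hpφ] at e
  intro h0
  rw [h0, mul_zero, sq_eq_zero_iff] at e
  exact hφ.fderiv_symm_ne_zero (φ.map_source hpφ) (k := (0, 1)) (by simp) (by simpa using e)

theorem PlaneFoliation.leaf_subset {L : Set Plane} (hL : L ∈ F.leaves) : L ⊆ Ω :=
  F.sUnion_leaves ▸ subset_sUnion_of_mem hL

theorem PlaneFoliation.exists_leaf {p : Plane} (hp : p ∈ Ω) : ∃ L ∈ F.leaves, p ∈ L := by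
  rw [← F.sUnion_leaves] at hp
  exact hp

theorem PlaneFoliation.leaf_eq {L M : Set Plane} (hL : L ∈ F.leaves) (hM : M ∈ F.leaves)
    {p : Plane} (hp : p ∈ L) (hp' : p ∈ M) : L = M := by
  by_contra h
  exact disjoint_left.1 (F.disjoint_leaves hL hM h) hp hp'

theorem Straightens.mem_leaf {φ : OpenPartialHomeomorph Plane (ℝ × ℝ)}
    (hs : Straightens φ Prod.fst F.leaves) {L : Set Plane} (hL : L ∈ F.leaves) {x y : Plane}
    (hx : x ∈ L) (hxs : x ∈ φ.source) (hys : y ∈ φ.source) (h : (φ y).1 = (φ x).1) : y ∈ L := by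
  have : y ∈ connectedComponentIn (L ∩ φ.source) x := by
    rw [hs L hL x ⟨hx, hxs⟩]; exact ⟨hys, h⟩
  exact (connectedComponentIn_subset _ _ this).1

theorem eq_of_isFirstIntegralAt {E : Type*} [NormedAddCommGroup E] [NormedSpace ℝ E]
    {φ : OpenPartialHomeomorph Plane (ℝ × ℝ)} (hφ : IsRectChart φ)
    (hd : ∀ w ∈ φ.target, ∃ r : ℝ, 0 < r ∧
      planeToComplex (fderiv ℝ φ.symm w (0, 1)) ^ 2 = r * Q (planeToComplex (φ.symm w)))
    {f : ℂ → E} (hf : ∀ x ∈ φ.source, IsFirstIntegralAt Q f (planeToComplex x))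
    {x y : Plane} (hx : x ∈ φ.source) (hy : y ∈ φ.source) (hxy : (φ y).1 = (φ x).1) :
    f (planeToComplex y) = f (planeToComplex x) := by
  obtain ⟨a, b, c, d, e⟩ := hφ.1
  have hx' := φ.map_source hx
  have hy' := φ.map_source hy
  have mem : ∀ t ∈ Ioo c d, ((φ x).1, t) ∈ φ.target := by
    rw [e] at hx' ⊢
    exact fun t ht => ⟨hx'.1, ht⟩
  have der : ∀ t ∈ Ioo c d,
      HasDerivAt (fun t => f (planeToComplex (φ.symm ((φ x).1, t)))) 0 t := by
    intro t ht
    obtain ⟨f', hf', h0⟩ := hf _ (φ.map_target (mem t ht))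
    obtain ⟨r, hr, hr'⟩ := hd _ (mem t ht)
    rw [← h0 _ r hr hr']
    exact hf'.comp_hasDerivAt t (hφ.hasDerivAt_snd (mem t ht))
  have key := isOpen_Ioo.is_const_of_deriv_eq_zero isPreconnected_Ioo
    (fun t ht => (der t ht).differentiableAt.differentiableWithinAt)
    (fun t ht => (der t ht).deriv) (x := (φ y).2) (y := (φ x).2)
    (by rw [e] at hy'; exact hy'.2) (by rw [e] at hx'; exact hx'.2)
  have e1 : ((φ x).1, (φ y).2) = φ y := by rw [← hxy]
  have e2 : ((φ x).1, (φ x).2) = φ x := rfl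
  simpa only [e1, e2, φ.left_inv hx, φ.left_inv hy] using key

/-- A leaf may meet a chart in several plaques, so the argument follows a path inside the leaf: for
a short time the path stays in one component of the leaf within the chart, that is in one plaque,
where `f` is constant. -/
theorem PlaneFoliation.IsDirectedBy.eq_on_leaf {E : Type*} [NormedAddCommGroup E] [NormedSpace ℝ E]
    (hF : F.IsDirectedBy Q) {f : ℂ → E}
    (hf : ∀ x ∈ Ω, IsFirstIntegralAt Q f (planeToComplex x)) {L : Set Plane} (hL : L ∈ F.leaves)
    {x y : Plane} (hx : x ∈ L) (hy : y ∈ L) : f (planeToComplex x) = f (planeToComplex y) := by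
  obtain ⟨γ, hγ⟩ := (F.isPathConnected_leaf L hL).joinedIn x hx y hy
  have hγ' : ∀ t : ℝ, γ.extend t ∈ L := fun t => by
    have : γ.extend t ∈ range γ := γ.extend_range ▸ mem_range_self t
    obtain ⟨t', ht'⟩ := this
    exact ht' ▸ hγ t'
  have hloc : IsLocallyConstant fun t => f (planeToComplex (γ.extend t)) := by
    rw [IsLocallyConstant.iff_eventually_eq]
    intro t
    obtain ⟨φ, hpφ, hφΩ, hφ, hs, hd⟩ := hF (γ.extend t) (F.leaf_subset hL (hγ' t))
    have ho : IsOpen (γ.extend ⁻¹' φ.source) := φ.open_source.preimage γ.continuous_extend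
    have hmem : γ.extend ⁻¹' φ.source ∈ nhds t := ho.mem_nhds hpφ
    filter_upwards [connectedComponentIn_mem_nhds hmem] with t' ht'
    have hsub := connectedComponentIn_subset (γ.extend ⁻¹' φ.source) t
    have hpre : IsPreconnected (γ.extend '' connectedComponentIn (γ.extend ⁻¹' φ.source) t) :=
      isPreconnected_connectedComponentIn.image _ γ.continuous_extend.continuousOn
    have h1 : γ.extend '' connectedComponentIn (γ.extend ⁻¹' φ.source) t ⊆
        connectedComponentIn (L ∩ φ.source) (γ.extend t) := by
      apply hpre.subset_connectedComponentIn
      · exact mem_image_of_mem _ (mem_connectedComponentIn hpφ)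
      · rintro _ ⟨t', ht', rfl⟩
        exact ⟨hγ' t', hsub ht'⟩
    have h2 := h1 (mem_image_of_mem _ ht')
    rw [hs L hL _ ⟨hγ' t, hpφ⟩] at h2
    exact eq_of_isFirstIntegralAt hφ hd (fun z hz => hf z (hφΩ hz)) hpφ h2.1 h2.2
  have := hloc.apply_eq_of_isPreconnected isPreconnected_univ (mem_univ 0) (mem_univ 1)
  simpa using this

/-- A subset of a regular level set which contains the leaf through `x` is, near `x`, contained
in that leaf. -/
theorem PlaneFoliation.eventually_mem_leaf {L : Set Plane} (hL : L ∈ F.leaves) {x : Plane}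
    (hx : x ∈ L) {C : Set Plane} (hLC : L ⊆ C) {k : ℂ → ℝ} {k' : ℂ →L[ℝ] ℝ}
    (hk : HasStrictFDerivAt k k' (planeToComplex x)) (hk' : k' ≠ 0)
    (hC : ∀ᶠ y in nhds x, y ∈ C → k (planeToComplex y) = k (planeToComplex x)) :
    ∀ᶠ y in nhds x, y ∈ C → y ∈ L := by
  obtain ⟨φ, hxφ, hφΩ, hφ, hs⟩ := F.exists_chart x (F.leaf_subset hL hx)
  have hw := φ.map_source hxφ
  set w := φ x with hwd
  have hwx : φ.symm w = x := φ.left_inv hxφ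
  have hψ : HasStrictFDerivAt (fun w => planeToComplex (φ.symm w))
      (planeToComplex.toContinuousLinearEquiv.toContinuousLinearMap.comp (fderiv ℝ φ.symm w)) w :=
    planeToComplex.toContinuousLinearEquiv.toContinuousLinearMap.hasStrictFDerivAt.comp w
      ((hφ.2.2.contDiffAt (φ.open_target.mem_nhds hw)).hasStrictFDerivAt (by simp))
  have hk2 : HasStrictFDerivAt k k' (planeToComplex (φ.symm w)) := by rwa [hwx]
  have hcomp := hk2.comp w hψ
  set D := k'.comp
    (planeToComplex.toContinuousLinearEquiv.toContinuousLinearMap.comp (fderiv ℝ φ.symm w)) with hD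
  have hcont : ContinuousAt φ x := φ.continuousAt hxφ
  have hCw : ∀ᶠ v in nhds w, φ.symm v ∈ C →
      k (planeToComplex (φ.symm v)) = k (planeToComplex x) := by
    have := (φ.symm.continuousAt hw)
    rw [ContinuousAt, hwx] at this
    exact this.eventually hC
  have hplaque : ∀ v ∈ φ.target, v.1 = w.1 → φ.symm v ∈ L := by
    intro v hv h
    refine hs.mem_leaf hL hx hxφ (φ.map_target hv) ?_
    rw [φ.right_inv hv, h]
  have htgt : ∀ᶠ v in nhds w, v ∈ φ.target := φ.open_target.mem_nhds hw
  -- The plaque through `x` lies in `C`, so `k` is constant along it.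
  have D2 : D (0, 1) = 0 := by
    have hline : HasDerivAt (fun t : ℝ => w + t • ((0, 1) : ℝ × ℝ)) (0, 1) 0 := by
      simpa using ((hasDerivAt_id (0 : ℝ)).smul_const ((0, 1) : ℝ × ℝ)).const_add w
    have h0 : w + (0 : ℝ) • ((0, 1) : ℝ × ℝ) = w := by simp
    have h1 : HasDerivAt (fun t : ℝ => (k ∘ fun w => planeToComplex (φ.symm w))
        (w + t • ((0, 1) : ℝ × ℝ))) (D (0, 1)) 0 :=
      HasFDerivAt.comp_hasDerivAt (0 : ℝ) (l := k ∘ fun w => planeToComplex (φ.symm w)) (l' := D)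
        (by rw [h0]; exact hcomp.hasFDerivAt) hline
    have h2 : (fun t : ℝ => (k ∘ fun w => planeToComplex (φ.symm w))
        (w + t • ((0, 1) : ℝ × ℝ))) =ᶠ[nhds 0] fun _ => k (planeToComplex x) := by
      have hc := hline.continuousAt
      rw [ContinuousAt, h0] at hc
      filter_upwards [hc.eventually (hCw.and htgt)] with t ht
      exact ht.1 (hLC (hplaque _ ht.2 (by simp)))
    exact (h1.congr_of_eventuallyEq h2.symm).unique (hasDerivAt_const _ _)
  -- Otherwise `D` would vanish, and with it `k'`, the derivative of the chart being invertible.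
  have D1 : D (1, 0) ≠ 0 := by
    intro D1
    apply hk'
    have hD0 : D = 0 := by
      ext
      · simpa using D1
      · simpa using D2
    have hinj : Function.Injective (fderiv ℝ φ.symm w) :=
      (injective_iff_map_eq_zero _).2 fun v hv => by
        by_contra hne; exact hφ.fderiv_symm_ne_zero hw hne hv
    have hrank : Module.finrank ℝ (ℝ × ℝ) = Module.finrank ℝ Plane := by simp
    have hsurj : Function.Surjective (fderiv ℝ φ.symm w) :=
      (LinearMap.injective_iff_surjective_of_finrank_eq_finrank hrank
        (f := (fderiv ℝ φ.symm w).toLinearMap)).1 hinj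
    apply ContinuousLinearMap.ext
    intro z
    obtain ⟨v, hv⟩ := hsurj (planeToComplex.symm z)
    have := DFunLike.congr_fun hD0 v
    simpa [hD, hv] using this
  -- Strict differentiability permits comparing `y` with the point of the plaque having the same
  -- second coordinate, although both move. With error constant |D(1, 0)|/2, a difference in the
  -- first coordinate would force different values of `k`.
  have hbound : ∀ᶠ p : (ℝ × ℝ) × (ℝ × ℝ) in nhds (w, w),
      ‖(k ∘ fun w => planeToComplex (φ.symm w)) p.1 - (k ∘ fun w => planeToComplex (φ.symm w)) p.2
        - D (p.1 - p.2)‖ ≤ |D (1, 0)| / 2 * ‖p.1 - p.2‖ :=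
    hcomp.isLittleO.bound (by positivity)
  have hpair : Filter.Tendsto (fun y : Plane => ((φ y, (w.1, (φ y).2)) : (ℝ × ℝ) × (ℝ × ℝ)))
      (nhds x) (nhds (w, w)) := by
    have h1 : ContinuousAt (fun y : Plane => ((φ y, (w.1, (φ y).2)) : (ℝ × ℝ) × (ℝ × ℝ))) x :=
      hcont.prodMk (continuousAt_const.prodMk (continuousAt_snd.comp hcont))
    exact h1
  have hpair2 : Filter.Tendsto (fun y : Plane => ((w.1, (φ y).2) : ℝ × ℝ)) (nhds x) (nhds w) :=
    (continuous_snd.tendsto _).comp hpair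
  filter_upwards [hpair.eventually hbound, hpair2.eventually (hCw.and htgt),
    φ.open_source.mem_nhds hxφ, hC] with y hb hy hys hyC hyC'
  refine hs.mem_leaf hL hx hxφ hys ?_
  by_contra hne
  have e1 : k (planeToComplex (φ.symm (w.1, (φ y).2))) = k (planeToComplex x) :=
    hy.1 (hLC (hplaque _ hy.2 rfl))
  have e2 : (φ y - (w.1, (φ y).2)) = ((φ y).1 - w.1) • ((1, 0) : ℝ × ℝ) := by
    ext <;> simp
  have hpos : 0 < |(φ y).1 - w.1| := abs_pos.2 (sub_ne_zero.2 hne)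
  have hDpos : 0 < |D (1, 0)| := abs_pos.2 D1
  simp only [Function.comp_apply, φ.left_inv hys, e1, hyC hyC', e2, map_smul, sub_self, zero_sub,
    norm_neg, norm_smul, Real.norm_eq_abs, Prod.norm_mk, smul_eq_mul, abs_mul, norm_one, norm_zero,
    zero_le_one, sup_of_le_left, mul_one] at hb
  nlinarith [mul_pos hpos hDpos]

/-- Criterion for a foliation to be formed by a family of curves that are unions of level sets of
a first integral. -/
theorem PlaneFoliation.IsDirectedBy.isFormedBy {E : Type*} [NormedAddCommGroup E]
    [NormedSpace ℝ E] (hF : F.IsDirectedBy Q) {f : ℂ → E}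
    (hf : ∀ x ∈ Ω, IsFirstIntegralAt Q f (planeToComplex x)) {𝒞 : Set (Set Plane)}
    (hcover : ∀ x ∈ Ω, ∃ C ∈ 𝒞, x ∈ C)
    (hsat : ∀ C ∈ 𝒞, ∀ x ∈ Ω, ∀ y ∈ Ω, f (planeToComplex x) = f (planeToComplex y) →
      x ∈ C → y ∈ C)
    (hreg : ∀ C ∈ 𝒞, ∀ x ∈ C ∩ Ω, ∃ (k : ℂ → ℝ) (k' : ℂ →L[ℝ] ℝ),
      HasStrictFDerivAt k k' (planeToComplex x) ∧ k' ≠ 0 ∧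
        ∀ᶠ y in nhds x, y ∈ C → k (planeToComplex y) = k (planeToComplex x)) :
    F.IsFormedBy 𝒞 := by
  have sub : ∀ L ∈ F.leaves, ∀ C ∈ 𝒞, ∀ x ∈ L, x ∈ C → L ⊆ C := fun L hL C hC x hx hxC y hy =>
    hsat C hC x (F.leaf_subset hL hx) y (F.leaf_subset hL hy) (hF.eq_on_leaf hf hL hx hy) hxC
  have near : ∀ L ∈ F.leaves, ∀ C ∈ 𝒞, ∀ x ∈ L, x ∈ C → ∀ᶠ y in nhds x, y ∈ C → y ∈ L := by
    intro L hL C hC x hx hxC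
    obtain ⟨k, k', hk, hk', hkC⟩ := hreg C hC x ⟨hxC, F.leaf_subset hL hx⟩
    exact F.eventually_mem_leaf hL hx (sub L hL C hC x hx hxC) hk hk' hkC
  have core : ∀ L ∈ F.leaves, ∀ C ∈ 𝒞, ∀ x ∈ L, x ∈ C → L = connectedComponentIn (C ∩ Ω) x := by
    intro L hL C hC x hx hxC
    apply Subset.antisymm
    · exact (F.isPathConnected_leaf L hL).isConnected.isPreconnected.subset_connectedComponentIn hx
        (subset_inter (sub L hL C hC x hx hxC) (F.leaf_subset hL))
    · set K := connectedComponentIn (C ∩ Ω) x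
      have hKsub : K ⊆ C ∩ Ω := connectedComponentIn_subset _ _
      have hxK : x ∈ K := mem_connectedComponentIn ⟨hxC, F.leaf_subset hL hx⟩
      have hK : IsPreconnected K := isPreconnected_connectedComponentIn
      -- By `near`, lying on the same leaf is a locally constant relation on the connected set `K`.
      have key : ∀ y ∈ K, ∀ M ∈ F.leaves, x ∈ M → y ∈ M := by
        intro y hy
        refine hK.induction₂' (fun y z => ∀ M ∈ F.leaves, y ∈ M → z ∈ M) (fun y hy => ?_)
          (fun y z t hy hz ht h1 h2 M hM hyM => h2 M hM (h1 M hM hyM)) hxK hy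
        obtain ⟨M, hM, hyM⟩ := F.exists_leaf (hKsub hy).2
        filter_upwards [nhdsWithin_le_nhds (near M hM C hC y hyM (hKsub hy).1),
          self_mem_nhdsWithin] with z hz hzK
        have hzM := hz (hKsub hzK).1
        refine ⟨fun N hN hyN => ?_, fun N hN hzN => ?_⟩
        · rwa [← F.leaf_eq hM hN hyM hyN]
        · rwa [← F.leaf_eq hM hN hzM hzN]
      exact fun y hy => key y hy L hL hx
  ext L
  constructor
  · intro hL
    obtain ⟨x, hx⟩ := (F.isPathConnected_leaf L hL).nonempty
    obtain ⟨C, hC, hxC⟩ := hcover x (F.leaf_subset hL hx)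
    exact ⟨C, hC, x, ⟨hxC, F.leaf_subset hL hx⟩, core L hL C hC x hx hxC⟩
  · rintro ⟨C, hC, p, hp, rfl⟩
    obtain ⟨M, hM, hpM⟩ := F.exists_leaf hp.2
    rwa [← core M hM C hC p hpM hp.1]

end leaves

/-! ### Gluing the local quadratic polynomials -/

theorem IsRectChart.fderiv_symm_fderiv {φ : OpenPartialHomeomorph Plane (ℝ × ℝ)}
    (h : IsRectChart φ) {x : Plane} (hx : x ∈ φ.source) (k : Plane) :
    fderiv ℝ φ.symm (φ x) (fderiv ℝ φ x k) = k := by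
  have h1 := (h.differentiableAt_symm (φ.map_source hx)).hasFDerivAt.comp x
    (h.differentiableAt hx).hasFDerivAt
  have e : (φ.symm ∘ φ) =ᶠ[nhds x] id :=
    Filter.eventuallyEq_of_mem (φ.open_source.mem_nhds hx) fun y hy => φ.left_inv hy
  have := (h1.congr_of_eventuallyEq e.symm).unique (hasFDerivAt_id x)
  exact DFunLike.congr_fun this k

/-- The tangent direction of a leaf does not depend on the chart. -/
theorem Straightens.exists_tangent_eq_smul {Ω : Set Plane} {F : PlaneFoliation Ω}
    {φ₁ φ₂ : OpenPartialHomeomorph Plane (ℝ × ℝ)} (h₁ : IsRectChart φ₁) (h₂ : IsRectChart φ₂)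
    (s₁ : Straightens φ₁ Prod.fst F.leaves) (s₂ : Straightens φ₂ Prod.fst F.leaves)
    {x : Plane} (hx : x ∈ Ω) (hx₁ : x ∈ φ₁.source) (hx₂ : x ∈ φ₂.source) :
    ∃ μ : ℝ, fderiv ℝ φ₁.symm (φ₁ x) (0, 1) = μ • fderiv ℝ φ₂.symm (φ₂ x) (0, 1) := by
  set T := fderiv ℝ φ₁.symm (φ₁ x) (0, 1) with hT
  obtain ⟨L, hL, hxL⟩ := F.exists_leaf hx
  have hw := φ₁.map_source hx₁
  have hinv : φ₁.symm ((φ₁ x).1, (φ₁ x).2) = x := φ₁.left_inv hx₁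
  have hline : HasDerivAt (fun t : ℝ => (((φ₁ x).1, t) : ℝ × ℝ)) (0, 1) (φ₁ x).2 :=
    (hasDerivAt_const _ _).prodMk (hasDerivAt_id _)
  have hcurve : HasDerivAt (fun t : ℝ => φ₁.symm ((φ₁ x).1, t)) T (φ₁ x).2 :=
    (h₁.differentiableAt_symm hw).hasFDerivAt.comp_hasDerivAt (φ₁ x).2 hline
  have hφ₂ : HasFDerivAt φ₂ (fderiv ℝ φ₂ x) (φ₁.symm ((φ₁ x).1, (φ₁ x).2)) := by
    rw [hinv]; exact (h₂.differentiableAt hx₂).hasFDerivAt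
  have hd : HasDerivAt (fun t : ℝ => (φ₂ (φ₁.symm ((φ₁ x).1, t))).1) (fderiv ℝ φ₂ x T).1
      (φ₁ x).2 :=
    (ContinuousLinearMap.fst ℝ ℝ ℝ).hasFDerivAt.comp_hasDerivAt _
      (hφ₂.comp_hasDerivAt (φ₁ x).2 hcurve)
  have hev : ∀ᶠ t in nhds (φ₁ x).2, ((φ₁ x).1, t) ∈ φ₁.target ∧
      φ₁.symm ((φ₁ x).1, t) ∈ φ₂.source := by
    refine (hline.continuousAt.eventually (φ₁.open_target.mem_nhds hw)).and ?_
    refine hcurve.continuousAt.eventually (φ₂.open_source.mem_nhds ?_)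
    change φ₁.symm ((φ₁ x).1, (φ₁ x).2) ∈ _
    rwa [hinv]
  obtain ⟨ε, hε, hball⟩ := Metric.eventually_nhds_iff_ball.1 hev
  -- A short piece of the plaque of `φ₁` is a connected subset of the leaf, hence lies in a single
  -- plaque of `φ₂`, where the first coordinate of `φ₂` is constant.
  have hpre : IsPreconnected ((fun t : ℝ => φ₁.symm ((φ₁ x).1, t)) '' Metric.ball (φ₁ x).2 ε) := by
    refine (convex_ball _ _).isPreconnected.image _ ?_
    exact φ₁.continuousOn_symm.comp (by fun_prop) fun t ht => (hball t ht).1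
  have hsub : (fun t : ℝ => φ₁.symm ((φ₁ x).1, t)) '' Metric.ball (φ₁ x).2 ε ⊆ L ∩ φ₂.source := by
    rintro _ ⟨t, ht, rfl⟩
    refine ⟨s₁.mem_leaf hL hxL hx₁ (φ₁.map_target (hball t ht).1) ?_, (hball t ht).2⟩
    simp only [φ₁.right_inv (hball t ht).1]
  have hcomp := hpre.subset_connectedComponentIn (x := x)
    ⟨(φ₁ x).2, Metric.mem_ball_self hε, hinv⟩ hsub
  rw [s₂ L hL x ⟨hxL, hx₂⟩] at hcomp
  have hconst : (fun t : ℝ => (φ₂ (φ₁.symm ((φ₁ x).1, t))).1) =ᶠ[nhds (φ₁ x).2]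
      fun _ => (φ₂ x).1 :=
    Filter.eventuallyEq_of_mem (Metric.ball_mem_nhds _ hε) fun t ht =>
      (hcomp (mem_image_of_mem _ ht)).2
  have h0 : (fderiv ℝ φ₂ x T).1 = 0 :=
    (hd.congr_of_eventuallyEq hconst.symm).unique (hasDerivAt_const _ _)
  refine ⟨(fderiv ℝ φ₂ x T).2, ?_⟩
  rw [← map_smul, ← h₂.fderiv_symm_fderiv hx₂ T]
  congr 1
  ext
  · simpa using h0
  · simp [h₂.fderiv_symm_fderiv hx₂ T]

/-- Two entire functions whose ratio is positive on a non-empty open set are positively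
proportional. -/
theorem exists_pos_proportional {Q₁ Q₂ : ℂ → ℂ} (h₁ : Differentiable ℂ Q₁)
    (h₂ : Differentiable ℂ Q₂) {O : Set ℂ} (hO : IsOpen O) {z₀ : ℂ} (hz₀ : z₀ ∈ O)
    (h : ∀ z ∈ O, Q₂ z ≠ 0 ∧ ∃ r : ℝ, 0 < r ∧ Q₁ z = r * Q₂ z) :
    ∃ r : ℝ, 0 < r ∧ ∀ z, Q₁ z = r * Q₂ z := by
  obtain ⟨ε, hε, hball⟩ := Metric.isOpen_iff.1 hO z₀ hz₀
  have hq : ∀ z ∈ Metric.ball z₀ ε, ∃ r : ℝ, 0 < r ∧ Q₁ z / Q₂ z = r := fun z hz => by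
    obtain ⟨h0, r, hr, e⟩ := h z (hball hz)
    exact ⟨r, hr, by rw [e, mul_div_cancel_right₀ _ h0]⟩
  have han : AnalyticOnNhd ℂ (fun z => Q₁ z / Q₂ z) (Metric.ball z₀ ε) := fun z hz =>
    (h₁.analyticAt z).div (h₂.analyticAt z) (h z (hball hz)).1
  have hz₀' := Metric.mem_ball_self (x := z₀) hε
  -- Open mapping theorem: the image of the ball lies on the real axis, so it contains no disc.
  have hconst : ∃ w, ∀ z ∈ Metric.ball z₀ ε, Q₁ z / Q₂ z = w := by
    refine (han.is_constant_or_isOpen (convex_ball _ _).isPreconnected).resolve_right fun ho => ?_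
    have himg := ho _ Subset.rfl Metric.isOpen_ball
    obtain ⟨δ, hδ, hsub⟩ := Metric.isOpen_iff.1 himg _ (mem_image_of_mem _ hz₀')
    obtain ⟨r, -, hr⟩ := hq z₀ hz₀'
    have hmem : Q₁ z₀ / Q₂ z₀ + (δ / 2 : ℝ) * Complex.I ∈ Metric.ball (Q₁ z₀ / Q₂ z₀) δ := by
      rw [Metric.mem_ball, dist_eq_norm, add_sub_cancel_left, norm_mul, Complex.norm_I, mul_one,
        Complex.norm_real, Real.norm_eq_abs, abs_of_pos (by positivity)]
      linarith
    obtain ⟨z, hz, e⟩ := hsub hmem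
    obtain ⟨r', -, hr'⟩ := hq z hz
    simp only [hr', hr] at e
    have := congrArg Complex.im e
    simp at this
    linarith
  obtain ⟨w, hw⟩ := hconst
  obtain ⟨r, hr, e⟩ := hq z₀ hz₀'
  have hwr : w = r := by rw [← hw z₀ hz₀', e]
  refine ⟨r, hr, ?_⟩
  have a1 : AnalyticOnNhd ℂ Q₁ univ := fun z _ => h₁.analyticAt z
  have a2 : AnalyticOnNhd ℂ (fun z => (r : ℂ) * Q₂ z) univ := fun z _ =>
    (h₂.const_mul (r : ℂ)).analyticAt z
  have := a1.eq_of_eventuallyEq a2 (z₀ := z₀) (by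
    filter_upwards [Metric.ball_mem_nhds z₀ hε] with z hz
    rw [← hwr, ← hw z hz, div_mul_cancel₀ _ (h z (hball hz)).1])
  exact fun z => congrFun this z

section swap

variable {φ : OpenPartialHomeomorph Plane (ℝ × ℝ)}

theorem IsRectChart.swap (hφ : IsRectChart φ) :
    IsRectChart (φ.transHomeomorph (Homeomorph.prodComm ℝ ℝ)) := by
  obtain ⟨⟨a, b, c, d, e⟩, h1, h2⟩ := hφ
  refine ⟨⟨c, d, a, b, ?_⟩, ?_, ?_⟩
  · ext w
    simp [e]
  · exact (contDiff_snd.prodMk contDiff_fst).comp_contDiffOn h1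
  · exact h2.comp (contDiff_snd.prodMk contDiff_fst).contDiffOn fun w hw => hw

theorem Straightens.swap {leaves : Set (Set Plane)} (h : Straightens φ Prod.snd leaves) :
    Straightens (φ.transHomeomorph (Homeomorph.prodComm ℝ ℝ)) Prod.fst leaves := h

theorem IsRectChart.fderiv_swap_symm (hφ : IsRectChart φ) {w : ℝ × ℝ} (hw : w.swap ∈ φ.target) :
    fderiv ℝ (φ.transHomeomorph (Homeomorph.prodComm ℝ ℝ)).symm w (0, 1) =
      fderiv ℝ φ.symm w.swap (1, 0) := by
  have h := (hφ.differentiableAt_symm hw).hasFDerivAt.comp w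
    ((ContinuousLinearMap.snd ℝ ℝ ℝ).prod (ContinuousLinearMap.fst ℝ ℝ ℝ)).hasFDerivAt
  have := DFunLike.congr_fun h.fderiv (0, 1)
  simpa using this

end swap

/-- The two foliations of a Liouville net are directed by a global quadratic polynomial with real
leading coefficient. -/
theorem IsLiouvilleNet.exists_quadratic {Ω : Set Plane} (hΩ : IsConnected Ω)
    {F₁ F₂ : PlaneFoliation Ω} (hF : IsLiouvilleNet F₁ F₂) :
    ∃ (c : ℝ) (β γ : ℂ), F₁.IsDirectedBy (fun z => -(c * z ^ 2 + 2 * β * z + γ)) ∧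
      F₂.IsDirectedBy (fun z => c * z ^ 2 + 2 * β * z + γ) := by
  have hloc : ∀ p : Ω, ∃ (φ : OpenPartialHomeomorph Plane (ℝ × ℝ)) (c : ℝ) (β γ : ℂ),
      p.1 ∈ φ.source ∧ φ.source ⊆ Ω ∧ IsRectChart φ ∧
      Straightens φ Prod.fst F₁.leaves ∧ Straightens φ Prod.snd F₂.leaves ∧
      ∀ w ∈ φ.target,
      (∃ r : ℝ, 0 < r ∧ planeToComplex (fderiv ℝ φ.symm w (1, 0)) ^ 2 =
        r * (c * planeToComplex (φ.symm w) ^ 2 + 2 * β * planeToComplex (φ.symm w) + γ)) ∧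
      ∃ r : ℝ, 0 < r ∧ planeToComplex (fderiv ℝ φ.symm w (0, 1)) ^ 2 =
        r * -(c * planeToComplex (φ.symm w) ^ 2 + 2 * β * planeToComplex (φ.symm w) + γ) := by
    intro p
    obtain ⟨φ, hp, hφΩ, hφ, s₁, s₂, hL⟩ := hF p p.2
    obtain ⟨c, β, γ, h⟩ := hL.exists_quadratic hφ ⟨_, φ.map_source hp⟩
    exact ⟨φ, c, β, γ, hp, hφΩ, hφ, s₁, s₂, h⟩
  choose φ c β γ hp hφΩ hφ s₁ s₂ hq using hloc
  set Q : Ω → ℂ → ℂ := fun p z => c p * z ^ 2 + 2 * β p * z + γ p with hQ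
  have dQ : ∀ p, Differentiable ℂ (Q p) := fun p => by simp only [hQ]; fun_prop
  -- In the two charts the tangent vectors of an `F₁`-leaf differ by a nonzero real factor μ, so
  -- their squares differ by μ² > 0.
  have overlap : ∀ p q : Ω, q.1 ∈ (φ p).source →
      ∃ r : ℝ, 0 < r ∧ ∀ z, Q p z = r * Q q z := by
    intro p q hqp
    refine exists_pos_proportional (dQ p) (dQ q)
      (O := planeToComplex '' ((φ p).source ∩ (φ q).source))
      (planeToComplex.toHomeomorph.isOpenMap _ ((φ p).open_source.inter (φ q).open_source))
      (mem_image_of_mem _ ⟨hqp, hp q⟩) ?_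
    rintro _ ⟨x, ⟨hx, hx'⟩, rfl⟩
    obtain ⟨μ, hμ⟩ := (s₁ p).exists_tangent_eq_smul (hφ p) (hφ q) (s₁ q) (hφΩ p hx) hx hx'
    obtain ⟨r, hr, e⟩ := (hq p _ ((φ p).map_source hx)).2
    obtain ⟨r', hr', e'⟩ := (hq q _ ((φ q).map_source hx')).2
    have n := (hφ p).fderiv_symm_ne_zero ((φ p).map_source hx) (k := (0, 1)) (by simp)
    have n' := (hφ q).fderiv_symm_ne_zero ((φ q).map_source hx') (k := (0, 1)) (by simp)
    have hμ0 : μ ≠ 0 := by rintro rfl; rw [zero_smul] at hμ; exact n hμ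
    rw [hμ, map_smul, Complex.real_smul, mul_pow, e', (φ p).left_inv hx, (φ q).left_inv hx'] at e
    rw [(φ q).left_inv hx'] at e'
    refine ⟨fun h0 => ?_, μ ^ 2 * r' / r, by positivity, ?_⟩
    · simp only [hQ] at h0
      rw [h0, neg_zero, mul_zero, sq_eq_zero_iff] at e'
      exact n' (by simpa using e')
    · have hrc : (r : ℂ) ≠ 0 := by exact_mod_cast hr.ne'
      simp only [hQ]
      push_cast
      field_simp
      linear_combination e
  obtain ⟨p₀, hp₀⟩ := hΩ.nonempty
  -- Positive proportionality is an equivalence relation and holds between nearby points, so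
  -- connectedness spreads it over Ω.
  have global : ∀ p : Ω, ∃ r : ℝ, 0 < r ∧ ∀ z, Q p z = r * Q ⟨p₀, hp₀⟩ z := by
    intro p
    have hsymm : ∀ p q : Ω, (∃ r : ℝ, 0 < r ∧ ∀ z, Q p z = r * Q q z) →
        ∃ r : ℝ, 0 < r ∧ ∀ z, Q q z = r * Q p z := by
      rintro p q ⟨r, hr, h⟩
      refine ⟨r⁻¹, by positivity, fun z => ?_⟩
      have hrc : (r : ℂ) ≠ 0 := by exact_mod_cast hr.ne'
      rw [h z]; push_cast; field_simp
    have := isPreconnected_iff_preconnectedSpace.1 hΩ.isPreconnected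
    refine isPreconnected_univ.induction₂' (α := Ω)
      (fun p q : Ω => ∃ r : ℝ, 0 < r ∧ ∀ z, Q p z = r * Q q z) (fun p _ => ?_) ?_
      (mem_univ p) (mem_univ _)
    · rw [nhdsWithin_univ]
      have : ∀ᶠ q : Ω in nhds p, q.1 ∈ (φ p).source :=
        continuous_subtype_val.continuousAt.eventually ((φ p).open_source.mem_nhds (hp p))
      filter_upwards [this] with q hq'
      exact ⟨overlap p q hq', hsymm _ _ (overlap p q hq')⟩
    · rintro p q t - - - ⟨r, hr, h⟩ ⟨r', hr', h'⟩
      refine ⟨r * r', by positivity, fun z => ?_⟩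
      rw [h z, h' z]; push_cast; ring
  refine ⟨c ⟨p₀, hp₀⟩, β ⟨p₀, hp₀⟩, γ ⟨p₀, hp₀⟩, fun p hpΩ => ?_, fun p hpΩ => ?_⟩
  · obtain ⟨s, hs, e⟩ := global ⟨p, hpΩ⟩
    refine ⟨φ ⟨p, hpΩ⟩, hp _, hφΩ _, hφ _, s₁ _, fun w hw => ?_⟩
    obtain ⟨r, hr, h⟩ := (hq _ w hw).2
    refine ⟨r * s, by positivity, ?_⟩
    rw [h]
    have := e (planeToComplex ((φ ⟨p, hpΩ⟩).symm w))
    simp only [hQ] at this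
    rw [this]; push_cast; ring
  · obtain ⟨s, hs, e⟩ := global ⟨p, hpΩ⟩
    refine ⟨(φ ⟨p, hpΩ⟩).transHomeomorph (Homeomorph.prodComm ℝ ℝ), hp _, hφΩ _, (hφ _).swap,
      (s₂ _).swap, fun w hw => ?_⟩
    obtain ⟨r, hr, h⟩ := (hq _ w.swap hw).1
    refine ⟨r * s, by positivity, ?_⟩
    rw [(hφ _).fderiv_swap_symm hw, h]
    have := e (planeToComplex ((φ ⟨p, hpΩ⟩).symm w.swap))
    simp only [hQ] at this
    rw [this]; push_cast
    exact (mul_assoc _ _ _).symm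

/-! ### Derivatives of distances and of line equations -/

section calculus

theorem hasStrictFDerivAt_norm_sub {z a : ℂ} (h : z ≠ a) :
    HasStrictFDerivAt (fun z => ‖z - a‖) (‖z - a‖⁻¹ • innerSL ℝ (z - a)) z := by
  have h0 : ‖z - a‖ ≠ 0 := norm_ne_zero_iff.2 (sub_ne_zero.2 h)
  have h1 : HasStrictFDerivAt (fun z : ℂ => z - a) (ContinuousLinearMap.id ℝ ℂ) z :=
    (hasStrictFDerivAt_id z).sub_const a
  have h2 := ((hasStrictFDerivAt_norm_sq (z - a)).comp z h1).sqrt (pow_ne_zero 2 h0)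
  simp only [Real.sqrt_sq (norm_nonneg _)] at h2
  refine h2.congr_fderiv ?_
  ext k
  simp
  field_simp

/-- The equation of a line has nonzero derivative. -/
theorem exists_hasStrictFDerivAt_line {e : ℂ} (he : e ≠ 0) (O z : ℂ) :
    ∃ k' : ℂ →L[ℝ] ℝ,
      HasStrictFDerivAt (fun z => ((z - O) * (starRingEnd ℂ) e).im) k' z ∧ k' ≠ 0 ∧
        ∀ h, k' h = (h * (starRingEnd ℂ) e).im := by
  have h1 : HasStrictFDerivAt (fun z : ℂ => z - O) (ContinuousLinearMap.id ℝ ℂ) z :=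
    (hasStrictFDerivAt_id z).sub_const O
  have h2 := Complex.imCLM.hasStrictFDerivAt.comp z (h1.mul_const ((starRingEnd ℂ) e))
  have key : ∀ h, (Complex.imCLM.comp ((starRingEnd ℂ) e • ContinuousLinearMap.id ℝ ℂ)) h =
      (h * (starRingEnd ℂ) e).im := fun h => by
    simp; ring
  refine ⟨_, h2, fun h0 => ?_, key⟩
  have := key (Complex.I * e)
  rw [h0, mul_assoc, Complex.mul_conj] at this
  simp at this
  exact he (Complex.normSq_eq_zero.1 this.symm)

theorem norm_mul_conj_sub (a b : ℂ) :
    ‖a - b‖ ^ 2 = ‖a‖ ^ 2 + ‖b‖ ^ 2 - 2 * (a * (starRingEnd ℂ) b).re := by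
  rw [← Complex.normSq_eq_norm_sq, ← Complex.normSq_eq_norm_sq, ← Complex.normSq_eq_norm_sq,
    Complex.normSq_sub]

end calculus

/-! ### Ellipses and hyperbolas -/

section focal

variable {A B : ℂ} {σ : ℝ}

/-- The reflection property: for σ = 1 the line of h bisects the angle of a and b, for σ = −1 that
of a and −b, so h has equal projections on a/|a| and σb/|b|. -/
theorem focal_reflection (hσ : σ ^ 2 = 1) {m : ℝ} (hm : 0 < m * σ) {a b h : ℂ}
    (e : h ^ 2 = m * (a * b)) :
    (h * (starRingEnd ℂ) a).re * ‖b‖ = σ * ((h * (starRingEnd ℂ) b).re * ‖a‖) := by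
  have hN : ‖h‖ ^ 2 = m * σ * (‖a‖ * ‖b‖) := by
    have hm' : |m| = m * σ := by
      have : |σ| = 1 := by rcases (sq_eq_sq_iff_eq_or_eq_neg.1 (hσ.trans (one_pow 2).symm)) with rfl | rfl <;> simp
      rw [← abs_of_pos hm, abs_mul, this, mul_one]
    rw [← norm_pow, e, norm_mul, norm_mul, Complex.norm_real, Real.norm_eq_abs, hm']
  have hcs : |(a * (starRingEnd ℂ) b).re| ≤ ‖a‖ * ‖b‖ := by
    simpa using Complex.abs_re_le_norm (a * (starRingEnd ℂ) b)
  have na := Complex.sq_norm a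
  have nb := Complex.sq_norm b
  have nh := Complex.sq_norm h
  have e1 := congrArg Complex.re e
  have e2 := congrArg Complex.im e
  have ha := norm_nonneg a
  have hb := norm_nonneg b
  generalize ‖a‖ = x at *
  generalize ‖b‖ = y at *
  generalize ‖h‖ = n at *
  simp only [Complex.normSq_apply, pow_two, Complex.mul_re, Complex.mul_im, Complex.ofReal_re,
    Complex.ofReal_im, Complex.conj_re, Complex.conj_im, zero_mul, sub_zero, add_zero] at *
  obtain ⟨a₁, a₂⟩ := a
  obtain ⟨b₁, b₂⟩ := b
  obtain ⟨h₁, h₂⟩ := h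
  simp only at *
  set p := h₁ * a₁ - h₂ * -a₂ with hp
  set q := h₁ * b₁ - h₂ * -b₂ with hq
  set D := a₁ * b₁ - a₂ * -b₂ with hD
  -- Half-angle formulas: 2(Re h ā)² = |h|²|a|² + Re(h² ā²), with h² = m a b inserted; similarly for
  -- b and for the mixed product.
  have hpp : 2 * (p * p) = x * x * (n * n + m * D) := by
    rw [na, nh, hp, hD]
    linear_combination (a₁ * a₁ - a₂ * a₂) * e1 + 2 * a₁ * a₂ * e2
  have hqq : 2 * (q * q) = y * y * (n * n + m * D) := by
    rw [nb, nh, hq, hD]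
    linear_combination (b₁ * b₁ - b₂ * b₂) * e1 + 2 * b₁ * b₂ * e2
  have hpq : 2 * (p * q) = m * (x * x) * (y * y) + n * n * D := by
    rw [na, nb, nh, hp, hq, hD]
    linear_combination (a₁ * b₁ - a₂ * b₂) * e1 + (a₁ * b₂ + a₂ * b₁) * e2
  have hsq : (p * y) ^ 2 = (σ * (q * x)) ^ 2 := by
    linear_combination y ^ 2 / 2 * hpp - σ * σ * x ^ 2 / 2 * hqq
      - x ^ 2 * y ^ 2 / 2 * (n * n + m * D) * hσ
  -- The squares agree; Cauchy–Schwarz makes the product nonnegative, which settles the sign.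
  have hprod : 0 ≤ (p * y) * (σ * (q * x)) := by
    have hσD : -(x * y) ≤ σ * D := by
      rcases mul_self_eq_one_iff.1 hσ with rfl | rfl <;> linarith [(abs_le.1 hcs).1, (abs_le.1 hcs).2]
    have : (p * y) * (σ * (q * x)) = (x * y) ^ 2 / 2 * (m * σ) * (x * y + σ * D) := by
      linear_combination σ * x * y / 2 * hpq + σ * x * y * D / 2 * hN
    rw [this]
    have : 0 ≤ x * y + σ * D := by linarith
    positivity
  rcases sq_eq_sq_iff_eq_or_eq_neg.1 hsq with h | h
  · exact h
  · rw [h] at hprod ⊢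
    have : σ * (q * x) = 0 := by nlinarith
    rw [this, neg_zero]

/-- The value σ = 1 serves the hyperbolas and σ = −1 the ellipses. The gradient is the difference of
the unit vectors appearing in `focal_reflection`. -/
theorem isFirstIntegralAt_focal (hσ : σ ^ 2 = 1) {κ : ℝ} (hκ : 0 < κ * σ) {Q : ℂ → ℂ}
    (hQ : ∀ z, Q z = κ * ((z - A) * (z - B))) {z : ℂ} (hA : z ≠ A) (hB : z ≠ B) :
    IsFirstIntegralAt Q (fun z => ‖z - A‖ - σ * ‖z - B‖) z := by
  refine ⟨_, ((hasStrictFDerivAt_norm_sub hA).sub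
    ((hasStrictFDerivAt_norm_sub hB).const_mul σ)).hasFDerivAt, fun h r hr e => ?_⟩
  rw [hQ] at e
  have ha : ‖z - A‖ ≠ 0 := norm_ne_zero_iff.2 (sub_ne_zero.2 hA)
  have hb : ‖z - B‖ ≠ 0 := norm_ne_zero_iff.2 (sub_ne_zero.2 hB)
  have := focal_reflection (m := r * κ) (a := z - A) (b := z - B) (h := h) hσ
    (by rw [mul_assoc]; exact mul_pos hr hκ) (by rw [e]; push_cast; ring)
  simp only [sub_apply, smul_apply, innerSL_apply_apply, smul_eq_mul, Complex.inner]
  field_simp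
  linarith

/-- With a = z − A and b = z − B one has a − b = B − A, so this is the equality case of the triangle
inequality: the law of cosines turns it into parallelism of a and b. -/
theorem norm_focal_sq_eq_iff (hσ : σ ^ 2 = 1) (a b : ℂ) :
    (‖a‖ - σ * ‖b‖) ^ 2 = ‖a - b‖ ^ 2 ↔ σ * (‖a‖ * ‖b‖) = (a * (starRingEnd ℂ) b).re := by
  rw [norm_mul_conj_sub]
  constructor <;> intro h
  · linear_combination -h / 2 + ‖b‖ ^ 2 / 2 * hσ
  · linear_combination -2 * h + ‖b‖ ^ 2 * hσ

/-- The gradient of the focal function can vanish only on the line AB, where the equation of that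
line is used instead. Squares appear because both branches of a hyperbola form one curve. -/
theorem exists_regular_focal (hσ : σ ^ 2 = 1) (hAB : A ≠ B) {z : ℂ} (hA : z ≠ A) (hB : z ≠ B) :
    ∃ (k : ℂ → ℝ) (k' : ℂ →L[ℝ] ℝ), HasStrictFDerivAt k k' z ∧ k' ≠ 0 ∧ ∀ᶠ w in nhds z,
      (‖w - A‖ - σ * ‖w - B‖) ^ 2 = (‖z - A‖ - σ * ‖z - B‖) ^ 2 → k w = k z := by
  have hd : ∀ w : ℂ, (w - A) - (w - B) = B - A := fun w => by ring
  by_cases hdeg : (‖z - A‖ - σ * ‖z - B‖) ^ 2 = ‖B - A‖ ^ 2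
  · obtain ⟨k', hk, hk', -⟩ := exists_hasStrictFDerivAt_line (sub_ne_zero.2 hAB.symm) A z
    have zero : ∀ w : ℂ, (‖w - A‖ - σ * ‖w - B‖) ^ 2 = ‖B - A‖ ^ 2 →
        ((w - A) * (starRingEnd ℂ) (B - A)).im = 0 := by
      intro w hw
      rw [← hd w, norm_focal_sq_eq_iff hσ] at hw
      have him : ((w - A) * (starRingEnd ℂ) (w - B)).im = 0 := by
        have h1 : |σ| = 1 := by
          rcases (sq_eq_sq_iff_eq_or_eq_neg.1 (hσ.trans (one_pow 2).symm)) with rfl | rfl <;> simp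
        rw [← Complex.abs_re_eq_norm, ← hw, abs_mul, h1, one_mul, abs_mul, abs_norm, abs_norm,
          norm_mul, RCLike.norm_conj]
      rw [← hd w, map_sub, mul_sub, Complex.sub_im, him, Complex.mul_conj]
      simp
    refine ⟨_, k', hk, hk', Filter.Eventually.of_forall fun w hw => ?_⟩
    rw [zero w (hw.trans hdeg), zero z hdeg]
  · have hs := (hasStrictFDerivAt_norm_sub hA).sub ((hasStrictFDerivAt_norm_sub hB).const_mul σ)
    refine ⟨_, _, hs, fun h0 => hdeg ?_, ?_⟩
    · have ha : ‖z - A‖ ≠ 0 := norm_ne_zero_iff.2 (sub_ne_zero.2 hA)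
      have hb : ‖z - B‖ ≠ 0 := norm_ne_zero_iff.2 (sub_ne_zero.2 hB)
      -- Testing the zero gradient on z − A gives exactly the equality case.
      have := DFunLike.congr_fun h0 (z - A)
      simp only [sub_apply, smul_apply, innerSL_apply_apply, smul_eq_mul, Complex.inner,
        Complex.mul_conj, Complex.ofReal_re, Complex.normSq_eq_norm_sq, zero_apply] at this
      rw [← hd z, norm_focal_sq_eq_iff hσ]
      field_simp at this
      linear_combination σ * this + ((z - A) * (starRingEnd ℂ) (z - B)).re * hσ
    · by_cases h0 : ‖z - A‖ - σ * ‖z - B‖ = 0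
      · refine Filter.Eventually.of_forall fun w hw => ?_
        rw [h0, zero_pow two_ne_zero, sq_eq_zero_iff] at hw
        exact hw.trans h0.symm
      · have hne : ‖z - A‖ - σ * ‖z - B‖ ≠ -(‖z - A‖ - σ * ‖z - B‖) := fun h => h0 (by linarith)
        filter_upwards [hs.continuousAt.eventually_ne hne] with w hw hw'
        exact (sq_eq_sq_iff_eq_or_eq_neg.1 hw').resolve_right hw

end focal

/-! ### Parabolas -/

section parabola

variable {A e : ℂ}

theorem hasStrictFDerivAt_parabolic {z : ℂ} (hA : z ≠ A) :
    HasStrictFDerivAt (fun z => ‖z - A‖ - ⟪e, z - A⟫)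
      (‖z - A‖⁻¹ • innerSL ℝ (z - A) - innerSL ℝ e) z := by
  refine (hasStrictFDerivAt_norm_sub hA).sub ?_
  have h1 : HasStrictFDerivAt (fun z : ℂ => z - A) (ContinuousLinearMap.id ℝ ℂ) z :=
    (hasStrictFDerivAt_id z).sub_const A
  exact ((innerSL ℝ e).hasStrictFDerivAt.comp z h1).congr_fderiv (by ext; simp)

/-- Reflection property of the parabola: h bisects the angle of e and a = z − A, so its projections
on e and a/|a| agree. -/
theorem isFirstIntegralAt_parabolic (he : ‖e‖ = 1) {κ : ℝ} (hκ : 0 < κ) {Q : ℂ → ℂ}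
    (hQ : ∀ z, Q z = κ * e * (z - A)) {z : ℂ} (hA : z ≠ A) :
    IsFirstIntegralAt Q (fun z => ‖z - A‖ - ⟪e, z - A⟫) z := by
  refine ⟨_, (hasStrictFDerivAt_parabolic hA).hasFDerivAt, fun h r hr eq => ?_⟩
  rw [hQ] at eq
  have ha : ‖z - A‖ ≠ 0 := norm_ne_zero_iff.2 (sub_ne_zero.2 hA)
  simp only [sub_apply, smul_apply, innerSL_apply_apply, smul_eq_mul, Complex.inner]
  generalize z - A = a at *
  have hN : h * (starRingEnd ℂ) h = r * κ * ‖a‖ := by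
    rw [Complex.mul_conj, Complex.normSq_eq_norm_sq, ← norm_pow, eq]
    simp [he, abs_of_pos hr, abs_of_pos hκ]
    ring
  have hee : e * (starRingEnd ℂ) e = 1 := by
    rw [Complex.mul_conj, Complex.normSq_eq_norm_sq, he]; simp
  have eq' := congrArg (starRingEnd ℂ) eq
  simp only [map_pow, map_mul, Complex.conj_ofReal] at eq'
  have hm : (r : ℂ) * κ ≠ 0 := by exact_mod_cast (mul_pos hr hκ).ne'
  -- Reflection in the line of h exchanges the directions of a and e.
  have key : h * (starRingEnd ℂ) a = ‖a‖ * (e * (starRingEnd ℂ) h) := by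
    apply mul_left_cancel₀ hm
    linear_combination -h * e * eq' + e * (starRingEnd ℂ) h * hN -
      h * r * κ * (starRingEnd ℂ) a * hee
  have key2 := congrArg Complex.re key
  rw [Complex.re_ofReal_mul] at key2
  rw [key2, ← Complex.conj_re (h * _)]
  simp only [map_mul, Complex.conj_conj]
  rw [mul_comm e]
  field_simp
  ring

/-- The gradient a/|a| − e vanishes only on the degenerate ray, where the equation of the axis takes
over. -/
theorem exists_regular_parabolic (he : ‖e‖ = 1) {z : ℂ} (hA : z ≠ A) :
    ∃ (k : ℂ → ℝ) (k' : ℂ →L[ℝ] ℝ), HasStrictFDerivAt k k' z ∧ k' ≠ 0 ∧ ∀ w : ℂ,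
      ‖w - A‖ - ⟪e, w - A⟫ = ‖z - A‖ - ⟪e, z - A⟫ → k w = k z := by
  by_cases hdeg : ‖z - A‖ - ⟪e, z - A⟫ = 0
  · have he0 : e ≠ 0 := by rintro rfl; simp at he
    obtain ⟨k', hk, hk', -⟩ := exists_hasStrictFDerivAt_line he0 A z
    have zero : ∀ w : ℂ, ‖w - A‖ - ⟪e, w - A⟫ = 0 → ((w - A) * (starRingEnd ℂ) e).im = 0 := by
      intro w hw
      rw [Complex.inner] at hw
      rw [← Complex.abs_re_eq_norm, norm_mul, RCLike.norm_conj, he, mul_one, ← sub_eq_zero.1 hw,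
        abs_norm]
    refine ⟨_, k', hk, hk', fun w hw => ?_⟩
    rw [zero w (hw.trans hdeg), zero z hdeg]
  · refine ⟨_, _, hasStrictFDerivAt_parabolic hA, fun h0 => hdeg ?_, fun w hw => hw⟩
    have ha : ‖z - A‖ ≠ 0 := norm_ne_zero_iff.2 (sub_ne_zero.2 hA)
    have := DFunLike.congr_fun h0 (z - A)
    simp only [sub_apply, smul_apply, innerSL_apply_apply, smul_eq_mul, zero_apply,
      real_inner_self_eq_norm_sq] at this
    rw [← this]
    field_simp

end parabola

theorem im_eq_zero_of_sq_eq_ofReal {w : ℂ} {m : ℝ} (hm : 0 ≤ m) (h : w ^ 2 = m) : w.im = 0 := by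
  have h₁ := congrArg Complex.re h
  have h₂ := congrArg Complex.im h
  simp only [pow_two w, Complex.mul_re, Complex.mul_im, Complex.ofReal_re, Complex.ofReal_im]
    at h₁ h₂
  rcases mul_eq_zero.1 (show w.re * w.im = 0 by linarith) with h | h
  · rw [h] at h₁; nlinarith
  · exact h

theorem re_eq_zero_of_sq_eq_ofReal {w : ℂ} {m : ℝ} (hm : m ≤ 0) (h : w ^ 2 = m) : w.re = 0 := by
  have := im_eq_zero_of_sq_eq_ofReal (w := Complex.I * w) (m := -m) (by linarith)
    (by rw [mul_pow, h, Complex.I_sq]; push_cast; ring)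
  simpa using this

/-! ### From the polynomial to the family of curves -/

section families

variable {Ω : Set Plane} {F : PlaneFoliation Ω} {Q : ℂ → ℂ}

theorem dist_eq_norm_planeToComplex (P A : Plane) :
    dist P A = ‖planeToComplex P - planeToComplex A‖ := by
  rw [← map_sub, LinearIsometryEquiv.norm_map, dist_eq_norm]

theorem eventually_planeToComplex {p : ℂ → Prop} {x : Plane}
    (h : ∀ᶠ w in nhds (planeToComplex x), p w) : ∀ᶠ y in nhds x, p (planeToComplex y) :=
  planeToComplex.continuous.continuousAt.eventually h

theorem PlaneFoliation.IsDirectedBy.isFormedBy_confocalHyperbolas (hF : F.IsDirectedBy Q)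
    {A B : Plane} (hAB : A ≠ B) {κ : ℝ} (hκ : 0 < κ)
    (hQ : ∀ z, Q z = κ * ((z - planeToComplex A) * (z - planeToComplex B))) :
    F.IsFormedBy (confocalHyperbolas A B) := by
  have hσ : (1 : ℝ) ^ 2 = 1 := by norm_num
  -- The foci are zeros of `Q`, and a directing polynomial has no zeros in Ω.
  have hA : ∀ x ∈ Ω, planeToComplex x ≠ planeToComplex A := fun x hx h =>
    hF.ne_zero hx (by rw [hQ, h]; simp)
  have hB : ∀ x ∈ Ω, planeToComplex x ≠ planeToComplex B := fun x hx h =>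
    hF.ne_zero hx (by rw [hQ, h]; simp)
  have hd : ∀ P, dist P A - dist P B = ‖planeToComplex P - planeToComplex A‖ -
      1 * ‖planeToComplex P - planeToComplex B‖ := fun P => by
    rw [dist_eq_norm_planeToComplex, dist_eq_norm_planeToComplex, one_mul]
  refine hF.isFormedBy (fun x hx => isFirstIntegralAt_focal hσ (by simpa using hκ) hQ (hA x hx)
    (hB x hx)) ?_ ?_ ?_
  · intro x _
    refine ⟨_, ⟨|dist x A - dist x B|, abs_nonneg _, ?_, rfl⟩, rfl⟩
    rw [dist_comm x A, dist_comm x B]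
    exact abs_dist_sub_le A B x
  · rintro _ ⟨s, -, -, rfl⟩ x - y - hxy hx
    simp only [mem_ofPred_eq, hd] at hx ⊢
    rw [← hx, hxy]
  · rintro _ ⟨s, -, -, rfl⟩ x ⟨hxs, hx⟩
    obtain ⟨k, k', hk, hk', hev⟩ := exists_regular_focal hσ
      (planeToComplex.injective.ne hAB) (hA x hx) (hB x hx)
    refine ⟨k, k', hk, hk', ?_⟩
    filter_upwards [eventually_planeToComplex hev] with y hy hys
    apply hy
    simp only [mem_ofPred_eq, hd] at hxs hys
    rw [← sq_abs, hys, ← hxs, sq_abs]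

theorem PlaneFoliation.IsDirectedBy.isFormedBy_confocalEllipses (hF : F.IsDirectedBy Q)
    {A B : Plane} (hAB : A ≠ B) {κ : ℝ} (hκ : κ < 0)
    (hQ : ∀ z, Q z = κ * ((z - planeToComplex A) * (z - planeToComplex B))) :
    F.IsFormedBy (confocalEllipses A B) := by
  have hσ : (-1 : ℝ) ^ 2 = 1 := by norm_num
  have hA : ∀ x ∈ Ω, planeToComplex x ≠ planeToComplex A := fun x hx h =>
    hF.ne_zero hx (by rw [hQ, h]; simp)
  have hB : ∀ x ∈ Ω, planeToComplex x ≠ planeToComplex B := fun x hx h =>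
    hF.ne_zero hx (by rw [hQ, h]; simp)
  have hd : ∀ P, dist P A + dist P B = ‖planeToComplex P - planeToComplex A‖ -
      -1 * ‖planeToComplex P - planeToComplex B‖ := fun P => by
    rw [dist_eq_norm_planeToComplex, dist_eq_norm_planeToComplex]; ring
  refine hF.isFormedBy (fun x hx => isFirstIntegralAt_focal hσ (by simpa using hκ) hQ (hA x hx)
    (hB x hx)) ?_ ?_ ?_
  · intro x _
    refine ⟨_, ⟨dist x A + dist x B, ?_, rfl⟩, rfl⟩
    rw [dist_comm x A]
    exact dist_triangle A x B
  · rintro _ ⟨s, -, rfl⟩ x - y - hxy hx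
    simp only [mem_ofPred_eq, hd] at hx ⊢
    rw [← hx, hxy]
  · rintro _ ⟨s, -, rfl⟩ x ⟨hxs, hx⟩
    obtain ⟨k, k', hk, hk', hev⟩ := exists_regular_focal hσ
      (planeToComplex.injective.ne hAB) (hA x hx) (hB x hx)
    refine ⟨k, k', hk, hk', ?_⟩
    filter_upwards [eventually_planeToComplex hev] with y hy hys
    apply hy
    simp only [mem_ofPred_eq, hd] at hxs hys
    rw [hys, hxs]

theorem PlaneFoliation.IsDirectedBy.isFormedBy_confocalParabolas (hF : F.IsDirectedBy Q)
    {A e : Plane} (he : ‖e‖ = 1) {κ : ℝ} (hκ : 0 < κ)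
    (hQ : ∀ z, Q z = κ * planeToComplex e * (z - planeToComplex A)) :
    F.IsFormedBy (confocalParabolas A e) := by
  have he' : ‖planeToComplex e‖ = 1 := by rw [LinearIsometryEquiv.norm_map, he]
  have hA : ∀ x ∈ Ω, planeToComplex x ≠ planeToComplex A := fun x hx h =>
    hF.ne_zero hx (by rw [hQ, h]; simp)
  have hd : ∀ (P : Plane) (s : ℝ), dist P A = ⟪P - A, e⟫ + s ↔
      ‖planeToComplex P - planeToComplex A‖ -
        ⟪planeToComplex e, planeToComplex P - planeToComplex A⟫ = s := fun P s => by
    rw [dist_eq_norm_planeToComplex, real_inner_comm, ← map_sub, LinearIsometryEquiv.inner_map_map,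
      sub_eq_iff_eq_add, add_comm]
  refine hF.isFormedBy (fun x hx => isFirstIntegralAt_parabolic he' hκ hQ (hA x hx)) ?_ ?_ ?_
  · intro x _
    refine ⟨_, ⟨dist x A - ⟪x - A, e⟫, ?_, rfl⟩, by simp⟩
    have := real_inner_le_norm (x - A) e
    rw [he, mul_one, ← dist_eq_norm] at this
    linarith
  · rintro _ ⟨s, -, rfl⟩ x - y - hxy hx
    simp only [mem_ofPred_eq, hd] at hx ⊢
    rw [← hx, hxy]
  · rintro _ ⟨s, -, rfl⟩ x ⟨hxs, hx⟩
    obtain ⟨k, k', hk, hk', hev⟩ := exists_regular_parabolic he' (hA x hx)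
    refine ⟨k, k', hk, hk', Filter.Eventually.of_forall fun y hys => hev _ ?_⟩
    simp only [mem_ofPred_eq, hd] at hxs hys
    rw [hys, hxs]

/-- With a = z − O, the number (h ā)² is real and nonpositive, so h is perpendicular to a. -/
theorem PlaneFoliation.IsDirectedBy.isFormedBy_concentricCircles (hF : F.IsDirectedBy Q)
    {O : Plane} {κ : ℝ} (hκ : κ < 0) (hQ : ∀ z, Q z = κ * (z - planeToComplex O) ^ 2) :
    F.IsFormedBy (concentricCircles O) := by
  have hO : ∀ x ∈ Ω, planeToComplex x ≠ planeToComplex O := fun x hx h =>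
    hF.ne_zero hx (by rw [hQ, h]; simp)
  refine hF.isFormedBy (f := fun z => ‖z - planeToComplex O‖) (fun x hx => ?_) ?_ ?_ ?_
  · refine ⟨_, (hasStrictFDerivAt_norm_sub (hO x hx)).hasFDerivAt, fun h r hr e => ?_⟩
    rw [hQ] at e
    simp only [smul_apply, innerSL_apply_apply, smul_eq_mul, Complex.inner]
    generalize planeToComplex x - planeToComplex O = a at *
    have e2 : (h * (starRingEnd ℂ) a) ^ 2 = ((r * κ * Complex.normSq a ^ 2 : ℝ) : ℂ) := by
      rw [mul_pow, e]
      push_cast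
      rw [← Complex.mul_conj]
      ring
    have hneg : r * κ * Complex.normSq a ^ 2 ≤ 0 :=
      mul_nonpos_of_nonpos_of_nonneg (mul_nonpos_of_nonneg_of_nonpos hr.le hκ.le) (sq_nonneg _)
    rw [re_eq_zero_of_sq_eq_ofReal hneg e2, mul_zero]
  · intro x hx
    refine ⟨_, ⟨dist x O, dist_pos.2 fun h => hO x hx (by rw [h]), rfl⟩, rfl⟩
  · rintro _ ⟨s, -, rfl⟩ x - y - hxy hx
    simp only [Metric.mem_sphere, dist_eq_norm_planeToComplex] at hx ⊢
    rw [← hx, hxy]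
  · rintro _ ⟨s, -, rfl⟩ x ⟨hxs, hx⟩
    have hn := norm_ne_zero_iff.2 (sub_ne_zero.2 (hO x hx))
    refine ⟨_, _, hasStrictFDerivAt_norm_sub (hO x hx), fun h0 => hn ?_,
      Filter.Eventually.of_forall fun y hys => ?_⟩
    · have := DFunLike.congr_fun h0 (planeToComplex x - planeToComplex O)
      simp only [smul_apply, innerSL_apply_apply, smul_eq_mul, zero_apply,
        real_inner_self_eq_norm_sq] at this
      field_simp at this
      exact this
    · simp only [Metric.mem_sphere, dist_eq_norm_planeToComplex] at hxs hys
      rw [hys, hxs]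

theorem planeToComplex_eq_line_iff {P O e : Plane} :
    (∃ t : ℝ, P = O + t • e) ↔
      ∃ t : ℝ, planeToComplex P - planeToComplex O = t * planeToComplex e := by
  refine exists_congr fun t => ?_
  rw [← planeToComplex.injective.eq_iff, map_add, map_smul, Complex.real_smul, sub_eq_iff_eq_add']

theorem exists_eq_ofReal_mul_iff {e : ℂ} (he : ‖e‖ = 1) (a : ℂ) :
    (∃ t : ℝ, a = t * e) ↔ (a * (starRingEnd ℂ) e).im = 0 := by
  have hee : e * (starRingEnd ℂ) e = 1 := by
    rw [Complex.mul_conj, Complex.normSq_eq_norm_sq, he]; simp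
  constructor
  · rintro ⟨t, rfl⟩
    rw [mul_assoc, hee, mul_one, Complex.ofReal_im]
  · intro h
    refine ⟨(a * (starRingEnd ℂ) e).re, ?_⟩
    have : (((a * (starRingEnd ℂ) e).re : ℝ) : ℂ) = a * (starRingEnd ℂ) e := by
      apply Complex.ext <;> simp only [Complex.ofReal_re, Complex.ofReal_im, h]
    rw [this, mul_assoc, mul_comm _ e, hee, mul_one]

theorem PlaneFoliation.IsDirectedBy.isFormedBy_parallelLines (hF : F.IsDirectedBy Q)
    {e : Plane} (he : ‖e‖ = 1) {κ : ℝ} (hκ : 0 < κ) (hQ : ∀ z, Q z = κ * planeToComplex e ^ 2) :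
    F.IsFormedBy (parallelLines e) := by
  have he' : ‖planeToComplex e‖ = 1 := by rw [LinearIsometryEquiv.norm_map, he]
  have he0 : planeToComplex e ≠ 0 := norm_ne_zero_iff.1 (by rw [he']; exact one_ne_zero)
  have hee : planeToComplex e * (starRingEnd ℂ) (planeToComplex e) = 1 := by
    rw [Complex.mul_conj, Complex.normSq_eq_norm_sq, he']; simp
  have line : ∀ P O : Plane, (∃ t : ℝ, P = O + t • e) ↔
      ((planeToComplex P - 0) * (starRingEnd ℂ) (planeToComplex e)).im =
        ((planeToComplex O - 0) * (starRingEnd ℂ) (planeToComplex e)).im := fun P O => by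
    rw [planeToComplex_eq_line_iff, exists_eq_ofReal_mul_iff he', sub_mul, Complex.sub_im,
      sub_eq_zero, sub_zero, sub_zero]
  refine hF.isFormedBy (f := fun z => ((z - 0) * (starRingEnd ℂ) (planeToComplex e)).im)
    (fun x hx => ?_) ?_ ?_ ?_
  · obtain ⟨k', hk, -, hk'⟩ := exists_hasStrictFDerivAt_line he0 0 (planeToComplex x)
    refine ⟨k', hk.hasFDerivAt, fun h r hr eq => ?_⟩
    rw [hk']
    rw [hQ] at eq
    have e2 : (h * (starRingEnd ℂ) (planeToComplex e)) ^ 2 = ((r * κ : ℝ) : ℂ) := by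
      rw [mul_pow, eq]
      push_cast
      linear_combination (r * κ * (planeToComplex e * (starRingEnd ℂ) (planeToComplex e) + 1)) * hee
    exact im_eq_zero_of_sq_eq_ofReal (mul_pos hr hκ).le e2
  · intro x _
    exact ⟨_, ⟨x, rfl⟩, 0, by simp⟩
  · rintro _ ⟨P, rfl⟩ x - y - hxy hx
    simp only [mem_ofPred_eq, line] at hx ⊢
    exact hxy.symm.trans hx
  · rintro _ ⟨P, rfl⟩ x ⟨hxs, hx⟩
    obtain ⟨k', hk, hk', -⟩ := exists_hasStrictFDerivAt_line he0 0 (planeToComplex x)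
    refine ⟨_, k', hk, hk', Filter.Eventually.of_forall fun y hys => ?_⟩
    simp only [mem_ofPred_eq, line] at hxs hys
    exact hys.trans hxs.symm

/-- The first integral is a/ā with a = z − O, the square of the direction of a. Unlike the argument
it is single-valued, and it agrees on opposite rays, which belong to one line. -/
theorem PlaneFoliation.IsDirectedBy.isFormedBy_radialLines (hF : F.IsDirectedBy Q)
    {O : Plane} {κ : ℝ} (hκ : 0 < κ) (hQ : ∀ z, Q z = κ * (z - planeToComplex O) ^ 2) :
    F.IsFormedBy (radialLines O) := by
  have hO : ∀ x ∈ Ω, planeToComplex x - planeToComplex O ≠ 0 := fun x hx h =>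
    hF.ne_zero hx (by rw [hQ, h]; simp)
  have unit : ∀ {e : Plane}, ‖e‖ = 1 → ‖planeToComplex e‖ = 1 := fun he => by
    rw [LinearIsometryEquiv.norm_map, he]
  refine hF.isFormedBy
    (f := fun z => (z - planeToComplex O) * ((starRingEnd ℂ) (z - planeToComplex O))⁻¹)
    (fun x hx => ?_) ?_ ?_ ?_
  · have ha := hO x hx
    have ha' : (starRingEnd ℂ) (planeToComplex x - planeToComplex O) ≠ 0 :=
      (map_ne_zero _).2 ha
    have h1 : HasFDerivAt (fun z : ℂ => z - planeToComplex O) (ContinuousLinearMap.id ℝ ℂ)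
      (planeToComplex x) := (hasFDerivAt_id _).sub_const _
    have h2 := Complex.conjCLE.toContinuousLinearMap.hasFDerivAt.comp (planeToComplex x) h1
    have h3 := ((hasDerivAt_inv ha').hasFDerivAt.restrictScalars ℝ).comp (planeToComplex x) h2
    refine ⟨_, h1.mul h3, fun h r hr eq => ?_⟩
    rw [hQ] at eq
    simp only [add_apply, smul_apply, ContinuousLinearMap.comp_apply, smul_eq_mul]
    change (planeToComplex x - planeToComplex O) * ((starRingEnd ℂ) h •
      (-((starRingEnd ℂ) (planeToComplex x - planeToComplex O) ^ 2)⁻¹)) +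
      ((starRingEnd ℂ) (planeToComplex x - planeToComplex O))⁻¹ * h = 0
    generalize planeToComplex x - planeToComplex O = a at *
    have e2 : (h * (starRingEnd ℂ) a) ^ 2 = ((r * κ * Complex.normSq a ^ 2 : ℝ) : ℂ) := by
      rw [mul_pow, eq]
      push_cast
      rw [← Complex.mul_conj]
      ring
    have him := Complex.conj_eq_iff_im.2 (im_eq_zero_of_sq_eq_ofReal (by positivity) e2)
    rw [map_mul, Complex.conj_conj] at him
    rw [smul_eq_mul]
    field_simp
    linear_combination -him
  · intro x hx
    have hn : ‖x - O‖ ≠ 0 := by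
      rw [← dist_eq_norm, dist_eq_norm_planeToComplex]; exact norm_ne_zero_iff.2 (hO x hx)
    refine ⟨_, ⟨‖x - O‖⁻¹ • (x - O), ?_, rfl⟩, ‖x - O‖, ?_⟩
    · rw [norm_smul, norm_inv, norm_norm, inv_mul_cancel₀ hn]
    · rw [smul_smul, mul_inv_cancel₀ hn, one_smul, add_sub_cancel]
  · rintro _ ⟨e, he, rfl⟩ x hx y hy hxy hxe
    simp only [mem_ofPred_eq, planeToComplex_eq_line_iff] at hxe ⊢
    have hx' := hO x hx
    have hy' := hO y hy
    obtain ⟨t, ht⟩ := hxe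
    rw [exists_eq_ofReal_mul_iff (unit he)]
    generalize planeToComplex x - planeToComplex O = a at *
    generalize planeToComplex y - planeToComplex O = b at *
    have hb' : (starRingEnd ℂ) b ≠ 0 := by simpa using hy'
    have ha' : (starRingEnd ℂ) a ≠ 0 := by simpa using hx'
    have ht0 : (t : ℂ) ≠ 0 := by rintro h0; rw [h0, zero_mul] at ht; exact hx' ht
    rw [← div_eq_mul_inv, ← div_eq_mul_inv, div_eq_div_iff ha' hb', ht, map_mul,
      Complex.conj_ofReal] at hxy
    have : (starRingEnd ℂ) (b * (starRingEnd ℂ) (planeToComplex e)) =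
        b * (starRingEnd ℂ) (planeToComplex e) := by
      rw [map_mul, Complex.conj_conj]
      apply mul_left_cancel₀ ht0
      linear_combination hxy
    exact Complex.conj_eq_iff_im.1 this
  · rintro _ ⟨e, he, rfl⟩ x ⟨hxs, hx⟩
    have he0 : planeToComplex e ≠ 0 := norm_ne_zero_iff.1 (by rw [unit he]; exact one_ne_zero)
    obtain ⟨k', hk, hk', -⟩ :=
      exists_hasStrictFDerivAt_line he0 (planeToComplex O) (planeToComplex x)
    refine ⟨_, k', hk, hk', Filter.Eventually.of_forall fun y hys => ?_⟩
    simp only [mem_ofPred_eq, planeToComplex_eq_line_iff, exists_eq_ofReal_mul_iff (unit he)]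
      at hxs hys
    exact hys.trans hxs.symm

end families

theorem exists_unit_mul_norm {γ : ℂ} (h : γ ≠ 0) : ∃ e : Plane, ‖e‖ = 1 ∧
    γ = (‖γ‖ : ℝ) * planeToComplex e := by
  have hn : ‖γ‖ ≠ 0 := norm_ne_zero_iff.2 h
  refine ⟨planeToComplex.symm ((‖γ‖⁻¹ : ℝ) • γ), ?_, ?_⟩
  · rw [LinearIsometryEquiv.norm_map, norm_smul, norm_inv, norm_norm, inv_mul_cancel₀ hn]
  · rw [LinearIsometryEquiv.apply_symm_apply, Complex.real_smul, ← mul_assoc, ← Complex.ofReal_mul,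
      mul_inv_cancel₀ hn, Complex.ofReal_one, one_mul]

/-! ### Classification by the roots of the polynomial -/

section classification

variable {Ω : Set Plane} {F₁ F₂ : PlaneFoliation Ω}

theorem isOrthogonalLineNet_of_isDirectedBy {γ : ℂ} (hγ : γ ≠ 0)
    (h₁ : F₁.IsDirectedBy fun _ => -γ) (h₂ : F₂.IsDirectedBy fun _ => γ) :
    IsOrthogonalLineNet F₁ F₂ := by
  -- A square root of γ directs `F₂`; multiplied by i, it directs `F₁`.
  obtain ⟨g, hg⟩ := IsAlgClosed.exists_pow_nat_eq γ two_pos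
  have hg0 : g ≠ 0 := by rintro rfl; exact hγ (by rw [← hg]; simp)
  obtain ⟨e, he, hge⟩ := exists_unit_mul_norm hg0
  have hpos : 0 < ‖g‖ ^ 2 := by positivity
  have hJ : planeToComplex (planeToComplex.symm (Complex.I * planeToComplex e)) =
    Complex.I * planeToComplex e := LinearIsometryEquiv.apply_symm_apply _ _
  have he' : ‖planeToComplex.symm (Complex.I * planeToComplex e)‖ = 1 := by
    rw [LinearIsometryEquiv.norm_map, norm_mul, Complex.norm_I, one_mul,
      LinearIsometryEquiv.norm_map, he]
  have hγe : γ = (‖g‖ ^ 2 : ℝ) * planeToComplex e ^ 2 := by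
    rw [← hg, hge]
    simp [he, mul_pow]
  refine ⟨planeToComplex.symm (Complex.I * planeToComplex e), e, he', he, ?_,
    h₁.isFormedBy_parallelLines he' hpos fun z => ?_,
    h₂.isFormedBy_parallelLines he hpos fun z => hγe⟩
  · rw [← planeToComplex.inner_map_map, hJ, Complex.inner]
    simp
    ring
  · rw [hJ, mul_pow, Complex.I_sq, hγe]
    ring

theorem isConfocalParabolicNet_of_isDirectedBy {β γ : ℂ} (hβ : β ≠ 0)
    (h₁ : F₁.IsDirectedBy fun z => -(2 * β * z + γ))
    (h₂ : F₂.IsDirectedBy fun z => 2 * β * z + γ) : IsConfocalParabolicNet F₁ F₂ := by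
  -- The focus is the root of the linear polynomial, and −β/|β| is the direction of the axis for
  -- `F₁`.
  obtain ⟨e, he, hβe⟩ := exists_unit_mul_norm (neg_ne_zero.2 hβ)
  rw [norm_neg] at hβe
  have hpos : 0 < 2 * ‖β‖ := by positivity
  have hA : planeToComplex (planeToComplex.symm (-γ / (2 * β))) = -γ / (2 * β) :=
    LinearIsometryEquiv.apply_symm_apply _ _
  have fac : ∀ z, 2 * β * z + γ = (2 * β) * (z - -γ / (2 * β)) := fun z => by
    field_simp
    ring
  refine ⟨planeToComplex.symm (-γ / (2 * β)), e, he,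
    h₁.isFormedBy_confocalParabolas he hpos fun z => ?_,
    h₂.isFormedBy_confocalParabolas (by rwa [norm_neg]) hpos fun z => ?_⟩
  · rw [hA, fac]
    push_cast
    linear_combination 2 * (z - -γ / (2 * β)) * hβe
  · rw [hA, fac, map_neg]
    push_cast
    linear_combination -2 * (z - -γ / (2 * β)) * hβe

/-- As c is real, only its sign matters: it decides which foliation carries the ellipses or circles.
-/
theorem isConfocalEllipticNet_or_isCircleRadialNet_of_isDirectedBy {c : ℝ} (hc : c ≠ 0) {A B : ℂ}
    (h₁ : F₁.IsDirectedBy fun z => -(c * ((z - A) * (z - B))))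
    (h₂ : F₂.IsDirectedBy fun z => c * ((z - A) * (z - B))) :
    IsConfocalEllipticNet F₁ F₂ ∨ IsCircleRadialNet F₁ F₂ := by
  obtain ⟨A, rfl⟩ := planeToComplex.surjective A
  obtain ⟨B, rfl⟩ := planeToComplex.surjective B
  by_cases hAB : A = B
  · subst hAB
    right
    refine ⟨A, ?_⟩
    rcases lt_or_gt_of_ne hc with h | h
    · exact Or.inr ⟨h₁.isFormedBy_radialLines (κ := -c) (by linarith) fun z => by push_cast; ring,
        h₂.isFormedBy_concentricCircles h fun z => by ring⟩
    · exact Or.inl ⟨h₁.isFormedBy_concentricCircles (κ := -c) (by linarith)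
        fun z => by push_cast; ring, h₂.isFormedBy_radialLines h fun z => by ring⟩
  · left
    refine ⟨A, B, hAB, ?_⟩
    rcases lt_or_gt_of_ne hc with h | h
    · exact Or.inr ⟨h₁.isFormedBy_confocalHyperbolas hAB (κ := -c) (by linarith)
        fun z => by push_cast; ring, h₂.isFormedBy_confocalEllipses hAB h fun z => rfl⟩
    · exact Or.inl ⟨h₁.isFormedBy_confocalEllipses hAB (κ := -c) (by linarith)
        fun z => by push_cast; ring, h₂.isFormedBy_confocalHyperbolas hAB h fun z => rfl⟩

end classification

theorem mainTheorem5 (Ω : Set Plane) (hΩ : IsOpen Ω) (hΩ' : IsConnected Ω)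
    (F₁ F₂ : PlaneFoliation Ω) (hF : IsLiouvilleNet F₁ F₂) :
    IsConfocalEllipticNet F₁ F₂ ∨ IsConfocalParabolicNet F₁ F₂ ∨ IsCircleRadialNet F₁ F₂ ∨ IsOrthogonalLineNet F₁ F₂ := by
  obtain ⟨c, β, γ, h₁, h₂⟩ := hF.exists_quadratic hΩ'
  by_cases hc : c = 0
  · subst hc
    simp only [Complex.ofReal_zero, zero_mul, zero_add] at h₁ h₂
    by_cases hβ : β = 0
    · subst hβ
      simp only [mul_zero, zero_mul, zero_add] at h₁ h₂
      obtain ⟨p, hp⟩ := hΩ'.nonempty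
      exact Or.inr (Or.inr (Or.inr (isOrthogonalLineNet_of_isDirectedBy (h₂.ne_zero hp) h₁ h₂)))
    · exact Or.inr (Or.inl (isConfocalParabolicNet_of_isDirectedBy hβ h₁ h₂))
  -- Here d is a square root of a quarter of the discriminant, so the roots are (−β ± d)/c.
  · obtain ⟨d, hd⟩ := IsAlgClosed.exists_pow_nat_eq (β ^ 2 - c * γ) two_pos
    have hc' : (c : ℂ) ≠ 0 := by exact_mod_cast hc
    have fac : ∀ z : ℂ, c * z ^ 2 + 2 * β * z + γ =
        c * ((z - (-β + d) / c) * (z - (-β - d) / c)) := fun z => by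
      field_simp
      linear_combination hd
    simp only [fac] at h₁ h₂
    rcases isConfocalEllipticNet_or_isCircleRadialNet_of_isDirectedBy hc h₁ h₂ with h | h
    · exact Or.inl h
    · exact Or.inr (Or.inr (Or.inl h))
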